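/- Let $n\ge 1$ be an integer, $0<b<\min\{2,n\}$ and $\gamma\in\{1,-1\}$. Let $\alpha_0$ be the positive root of $n\alpha^2+(n-2+2b)\alpha-4+2b=0$, put $2^*_b=\frac{4-2b}{n-2}$ if $n\ge 3$ and $2^*_b=\infty$ if $n\le 2$, and suppose $\alpha_0<\alpha<2^*_b$. Let $$r=\frac{n(\alpha+2)}{n-b},\qquad \beta=\frac{4-2b-\alpha(n-2)}{2\alpha(\alpha+2)},\qquad r<q\le\infty .$$ The Lorentz quasi-norm of a measurable $f:\mathbb R^n\to\mathbb C$ is $\|f\|_{L^{p,q}}=\big(\frac qp\int_0^\infty [s^{1/p}f^*(s)]^q\frac{ds}{s}\big)^{1/q}$ for $q<\infty$ and $\|f\|_{L^{p,\infty}}=\sup_{s>0}s^{1/p}f^*(s)$, where $f^*(s)=\inf\{\lambda>0: |\{|f|>\lambda\}|\le s\}$. Let $\mathcal X$ be the set of functions $u:\mathbb R^n\times\mathbb R\to\mathbb C$, with $u(t)=u(\cdot,t)$ measurable for $t>0$, such that $$|\!|\!|u|\!|\!|:=\sup_{t>0}t^\beta\|u(t)\|_{L^{r,q}}<\infty ,$$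 and let $\mathcal W$ be the set of tempered distributions $\varphi$ on $\mathbb R^n$ such that $e^{it\Delta}\varphi$, $t>0$, is given by a function in $\mathcal X$; here $e^{it\Delta}$ is the linear Schrödinger group acting on tempered distributions. A function $u\in\mathcal X$ is called a solution of $$i\partial_t u+\Delta u+\gamma|x|^{-b}|u|^\alpha u=0,\qquad u(0)=\varphi,$$ where $\varphi$ is a tempered distribution, if $$u(t)=e^{it\Delta}\varphi+i\gamma\int_0^t e^{i(t-\tau)\Delta}\big(|x|^{-b}|u|^\alpha u\big)(\tau)\,d\tau\qquad\text{for all } t>0,$$ as an identity of tempered distributions, in which the integral is taken weakly (it converges absolutely after pairing with any Schwartz function). Theorem (Scattering). There is a constant $C>0$, depending only on $n,b,\alpha,\gamma,q$, such that for every tempered distribution $\varphi$ and every solution $u\in\mathcal X$ with initial value $\varphi$ there exists $\psi_+\in\mathcal W$ with $$\|e^{-it\Delta}u(t)-\psi_+\|_{L^{r,q}}\le C\,t^{-\beta}\,|\!|\!|u|\!|\!|^{\alpha+1}\qquad\text{for all } t>0 .$$ In particular, the tempered distribution $e^{-it\Delta}u(t)-\psi_+$ is given by a function in $L^{r,q}$.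 -/

import Mathlib

open MeasureTheory Set
open scoped SchwartzMap ENNReal

namespace INLS

/-! ### Lorentz spaces on `ℝⁿ` -/

/-- The distribution function `d_f(s) = |{x : |f x| > s}|`. -/
noncomputable def distribFun {n : ℕ} (f : EuclideanSpace ℝ (Fin n) → ℂ) (s : ℝ) : ℝ≥0∞ :=
  volume {x | s < ‖f x‖}

/-- The decreasing rearrangement `f*(t) = inf {s > 0 : d_f(s) ≤ t}` (the infimum of the empty set
is `∞`). -/
noncomputable def rearrangement {n : ℕ} (f : EuclideanSpace ℝ (Fin n) → ℂ) (t : ℝ) : ℝ≥0∞ :=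
  ⨅ (s : ℝ) (_ : 0 < s ∧ distribFun f s ≤ ENNReal.ofReal t), ENNReal.ofReal s

/-- The Lorentz quasi-norm `‖f‖_{L^{p,q}}`, with values in `[0, ∞]`:
`((q/p) ∫₀^∞ (t^{1/p} f*(t))^q dt/t)^{1/q}` for `q < ∞`, and `sup_{t>0} t^{1/p} f*(t)` for
`q = ∞`. -/
noncomputable def lorentzNorm {n : ℕ} (p : ℝ) (q : ℝ≥0∞)
    (f : EuclideanSpace ℝ (Fin n) → ℂ) : ℝ≥0∞ :=
  if q = ∞ then
    ⨆ (t : ℝ) (_ : 0 < t), ENNReal.ofReal (t ^ (1 / p)) * rearrangement f t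
  else
    (ENNReal.ofReal (q.toReal / p) *
      ∫⁻ t in Ioi (0 : ℝ),
        (ENNReal.ofReal (t ^ (1 / p)) * rearrangement f t) ^ q.toReal * ENNReal.ofReal (1 / t))
      ^ (1 / q.toReal)

/-! ### Functions as tempered distributions, and the Schrödinger group -/

/-- The function `g` defines the tempered distribution `T`, that is, `T f = ∫ f g` for all Schwartz
functions `f`, the integrals being absolutely convergent. -/
def Represents {n : ℕ} (g : EuclideanSpace ℝ (Fin n) → ℂ)
    (T : 𝓢'(EuclideanSpace ℝ (Fin n), ℂ)) : Prop :=
  ∀ f : 𝓢(EuclideanSpace ℝ (Fin n), ℂ),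
    Integrable (fun x ↦ f x * g x) ∧ T f = ∫ x, f x * g x

/-- The `L^{p,q}` quasi-norm of a tempered distribution: the quasi-norm of the function that
defines it (which is unique up to a null set), and `∞` if there is no such function. -/
noncomputable def distLorentzNorm {n : ℕ} (p : ℝ) (q : ℝ≥0∞)
    (T : 𝓢'(EuclideanSpace ℝ (Fin n), ℂ)) : ℝ≥0∞ :=
  ⨅ (g : EuclideanSpace ℝ (Fin n) → ℂ) (_ : Represents g T), lorentzNorm p q g

/-- The Fourier symbol `exp(-4π² i t |ξ|²)` of `e^{itΔ}`, for the normalization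
`𝓕 f(ξ) = ∫ exp(-2π i x·ξ) f(x) dx`. -/
noncomputable def schrodingerSymbol {n : ℕ} (t : ℝ) (ξ : EuclideanSpace ℝ (Fin n)) : ℂ :=
  Complex.exp (((-(4 * Real.pi ^ 2 * t * ‖ξ‖ ^ 2) : ℝ) : ℂ) * Complex.I)

/-- The symbol and all its derivatives grow at most polynomially, so that the Fourier multiplier
below is the genuine one. -/
theorem schrodingerSymbol_hasTemperateGrowth {n : ℕ} (t : ℝ) :
    Function.HasTemperateGrowth
      (schrodingerSymbol t : EuclideanSpace ℝ (Fin n) → ℂ) := by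
  have hd : ∀ s : ℝ, HasDerivAt (fun s : ℝ ↦ Complex.exp ((s : ℂ) * Complex.I))
      (Complex.exp ((s : ℂ) * Complex.I) * Complex.I) s := fun s ↦ by
    simpa using ((Complex.ofRealCLM.hasDerivAt (x := s)).mul_const Complex.I).cexp
  have hiter : ∀ k : ℕ, iteratedDeriv k (fun s : ℝ ↦ Complex.exp ((s : ℂ) * Complex.I)) =
      fun s : ℝ ↦ Complex.exp ((s : ℂ) * Complex.I) * Complex.I ^ k := by
    intro k
    induction k with
    | zero => simp
    | succ k ih =>
      rw [iteratedDeriv_succ, ih]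
      funext s
      rw [((hd s).mul_const (Complex.I ^ k)).deriv]
      ring
  have hexp : Function.HasTemperateGrowth
      (fun s : ℝ ↦ Complex.exp ((s : ℂ) * Complex.I)) := by
    refine ⟨(Complex.ofRealCLM.contDiff.mul contDiff_const).cexp, fun k ↦ ⟨0, 1, fun s ↦ ?_⟩⟩
    rw [norm_iteratedFDeriv_eq_norm_iteratedDeriv, hiter k]
    simp [Complex.norm_exp_ofReal_mul_I]
  exact hexp.comp (f := fun ξ : EuclideanSpace ℝ (Fin n) ↦ -(4 * Real.pi ^ 2 * t * ‖ξ‖ ^ 2))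
    (by fun_prop)

/-- The linear Schrödinger group `e^{itΔ}` on tempered distributions. -/
noncomputable def schrodinger {n : ℕ} (t : ℝ) :
    𝓢'(EuclideanSpace ℝ (Fin n), ℂ) →L[ℂ] 𝓢'(EuclideanSpace ℝ (Fin n), ℂ) :=
  TemperedDistribution.fourierMultiplierCLM ℂ (schrodingerSymbol t)

/-! ### The exponents -/

/-- The upper exponent `2*_b`: `(4 - 2b)/(n - 2)` if `n ≥ 3`, and `∞` if `n ≤ 2`. -/
noncomputable def upperExponent (n : ℕ) (b : ℝ) : EReal :=
  if 3 ≤ n then (((4 - 2 * b) / ((n : ℝ) - 2) : ℝ) : EReal) else ⊤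

/-- `r = n(α + 2)/(n - b)`. -/
noncomputable def rExp (n : ℕ) (b α : ℝ) : ℝ := (n : ℝ) * (α + 2) / ((n : ℝ) - b)

/-- `β = (4 - 2b - α(n - 2)) / (2α(α + 2))`. -/
noncomputable def betaExp (n : ℕ) (b α : ℝ) : ℝ :=
  (4 - 2 * b - α * ((n : ℝ) - 2)) / (2 * α * (α + 2))

/-! ### The function classes and the equation -/

/-- `|||u||| = sup_{t>0} t^β ‖u(t)‖_{L^{r,q}}`, with values in `[0, ∞]`. -/
noncomputable def tripleNorm {n : ℕ} (b α : ℝ) (q : ℝ≥0∞)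
    (u : ℝ → EuclideanSpace ℝ (Fin n) → ℂ) : ℝ≥0∞ :=
  ⨆ (t : ℝ) (_ : 0 < t), ENNReal.ofReal (t ^ betaExp n b α) * lorentzNorm (rExp n b α) q (u t)

/-- The class `𝒳`: the functions `u(x, t)`, with `u(t)` measurable for `t > 0`, such that
`|||u||| < ∞`. -/
def classX (n : ℕ) (b α : ℝ) (q : ℝ≥0∞) : Set (ℝ → EuclideanSpace ℝ (Fin n) → ℂ) :=
  {u | (∀ t, 0 < t → AEStronglyMeasurable (u t) volume) ∧ tripleNorm b α q u < ∞}

/-- The class `𝒲`: the tempered distributions `φ` such that `e^{itΔ} φ` is, for `t > 0`, given by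
a function in `𝒳`. -/
def classW (n : ℕ) (b α : ℝ) (q : ℝ≥0∞) : Set 𝓢'(EuclideanSpace ℝ (Fin n), ℂ) :=
  {φ | ∃ v ∈ classX n b α q, ∀ t, 0 < t → Represents (v t) (schrodinger t φ)}

/-- The nonlinearity `|x|^{-b} |w|^α w`. -/
noncomputable def nonlinearity {n : ℕ} (b α : ℝ) (w : EuclideanSpace ℝ (Fin n) → ℂ) :
    EuclideanSpace ℝ (Fin n) → ℂ :=
  fun x ↦ ((‖x‖ ^ (-b) * ‖w x‖ ^ α : ℝ) : ℂ) * w x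

/-- `u` solves, for positive times, the initial value problem
`i ∂ₜu + Δu + γ |x|^{-b} |u|^α u = 0`, `u(0) = φ`, in its integral form
`u(t) = e^{itΔ} φ + i γ ∫₀ᵗ e^{i(t-τ)Δ} (|x|^{-b} |u|^α u)(τ) dτ`. This is an identity of tempered
distributions, the integral being taken weakly (after pairing with any Schwartz function). Here
`U t` is `u(t)`, and `G τ` is `(|x|^{-b} |u|^α u)(τ)`, as a distribution. -/
def IsSolution {n : ℕ} (b α γ : ℝ) (φ : 𝓢'(EuclideanSpace ℝ (Fin n), ℂ))
    (u : ℝ → EuclideanSpace ℝ (Fin n) → ℂ) : Prop :=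
  ∃ U G : ℝ → 𝓢'(EuclideanSpace ℝ (Fin n), ℂ),
    (∀ t, 0 < t → Represents (u t) (U t)) ∧
    (∀ t, 0 < t → Represents (nonlinearity b α (u t)) (G t)) ∧
    ∀ t, 0 < t → ∀ f : 𝓢(EuclideanSpace ℝ (Fin n), ℂ),
      IntegrableOn (fun τ ↦ schrodinger (t - τ) (G τ) f) (Ioo 0 t) ∧
      U t f = schrodinger t φ f +
        Complex.I * (γ : ℂ) * ∫ τ in Ioo 0 t, schrodinger (t - τ) (G τ) f

end INLS

namespace INLS

open FourierTransform

/-! Write G(τ) for the nonlinearity at time τ. By Duhamel's formula and the group law, e^{-itΔ}u(t)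
+ iγ∫_t^∞ e^{-iτΔ}G(τ)dτ does not depend on t; this is the scattering state ψ. So e^{-itΔ}u(t) - ψ
is, up to a unimodular factor, the tail ∫_t^∞ e^{-iτΔ}G(τ)dτ, while e^{itΔ}ψ is u(t) plus a
unimodular multiple of ∫_t^∞ e^{i(t-τ)Δ}G(τ)dτ. Both claims follow from one bound, by
t^{-β}|||u|||^{α+1} in L^{r,q}, for ∫_t^∞ e^{i(σ-τ)Δ}G(τ)dτ with σ ≤ t (`exists_duhamel_tail`),
taken at σ = 0 and σ = t.

For fixed τ the tail bound rests on a dispersive estimate of size |s|^{-n(1/2-1/r)} for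
e^{isΔ}(|x|^{-b}|w|^α w), a real interpolation carried out by hand in dual form. The L^{r,q} norm is
replaced by the ℓ^q norm of 2^{j/r}f*(2^j), and f*(2^j) is detected by Schwartz functions f_j with
‖f_j‖₁ ≤ 2^j, ‖f_j‖₂ ≤ 2^{j/2} (`exists_represents_lorentzNorm_le`). The group moves onto f_j, where
the L¹-L^∞ decay and the L² isometry both apply. Cutting ℝⁿ into layers of measure about 2^k on
which the nonlinearity is at most 2^{-kb/n}w*(2^k)^{α+1} gives a kernel in (j,k) that depends only
on j+k-l, with 2^l about |s|^n, and is summable; Young's inequality finishes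
(`exists_seqNorm_pairing_le`).

Minkowski's inequality in τ leaves ∫_t^∞ (τ-t)^{-a}τ^{-β(α+1)}dτ with a = n(1/2-1/r). The scaling
relation a + βα = 1 gives a < 1, hence integrability at τ = t, and total decay 1+β, hence the value
t^{-β} up to a constant. -/

/-! ### The group on test functions: L² isometry and dispersive decay -/

/-- The Schrödinger group on Schwartz functions, as the transpose of `schrodinger`. -/
noncomputable def schrodingerTest {n : ℕ} (t : ℝ) (f : 𝓢(EuclideanSpace ℝ (Fin n), ℂ)) :
    𝓢(EuclideanSpace ℝ (Fin n), ℂ) :=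
  𝓕 (SchwartzMap.smulLeftCLM ℂ (schrodingerSymbol t) (𝓕⁻ f))

theorem schrodinger_apply {n : ℕ} (t : ℝ) (T : 𝓢'(EuclideanSpace ℝ (Fin n), ℂ))
    (f : 𝓢(EuclideanSpace ℝ (Fin n), ℂ)) : schrodinger t T f = T (schrodingerTest t f) := rfl

theorem schrodingerSymbol_mul {n : ℕ} (s t : ℝ) :
    (schrodingerSymbol s * schrodingerSymbol t : EuclideanSpace ℝ (Fin n) → ℂ) =
      schrodingerSymbol (s + t) := by
  ext ξ
  simp only [schrodingerSymbol, Pi.mul_apply, ← Complex.exp_add]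
  congr 1
  push_cast
  ring

theorem norm_schrodingerSymbol {n : ℕ} (t : ℝ) (ξ : EuclideanSpace ℝ (Fin n)) :
    ‖schrodingerSymbol t ξ‖ = 1 := Complex.norm_exp_ofReal_mul_I _

theorem schrodingerTest_schrodingerTest {n : ℕ} (s t : ℝ)
    (f : 𝓢(EuclideanSpace ℝ (Fin n), ℂ)) :
    schrodingerTest s (schrodingerTest t f) = schrodingerTest (s + t) f := by
  simp only [schrodingerTest, FourierTransform.fourierInv_fourier_eq]
  rw [SchwartzMap.smulLeftCLM_smulLeftCLM_apply (schrodingerSymbol_hasTemperateGrowth _)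
    (schrodingerSymbol_hasTemperateGrowth _), schrodingerSymbol_mul]

theorem schrodingerTest_zero {n : ℕ} (f : 𝓢(EuclideanSpace ℝ (Fin n), ℂ)) :
    schrodingerTest 0 f = f := by
  have : (schrodingerSymbol 0 : EuclideanSpace ℝ (Fin n) → ℂ) = fun _ ↦ 1 := by
    ext; simp [schrodingerSymbol]
  simp [schrodingerTest, this]

theorem eLpNorm_two_fourier {n : ℕ} (f : 𝓢(EuclideanSpace ℝ (Fin n), ℂ)) :
    eLpNorm (𝓕 f : 𝓢(EuclideanSpace ℝ (Fin n), ℂ)) 2 volume = eLpNorm f 2 volume := by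
  have h := SchwartzMap.norm_fourier_toL2_eq f
  rw [SchwartzMap.norm_toLp, SchwartzMap.norm_toLp] at h
  exact (ENNReal.toReal_eq_toReal_iff' (SchwartzMap.memLp _ _ _).2.ne
    (SchwartzMap.memLp _ _ _).2.ne).1 h

theorem eLpNorm_two_schrodingerTest {n : ℕ} (t : ℝ) (f : 𝓢(EuclideanSpace ℝ (Fin n), ℂ)) :
    eLpNorm (schrodingerTest t f) 2 volume = eLpNorm f 2 volume := by
  rw [schrodingerTest, eLpNorm_two_fourier]
  have h1 : eLpNorm (SchwartzMap.smulLeftCLM ℂ (schrodingerSymbol t) (𝓕⁻ f)) 2 volume =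
      eLpNorm (𝓕⁻ f : 𝓢(EuclideanSpace ℝ (Fin n), ℂ)) 2 volume := by
    refine eLpNorm_congr_norm_ae (.of_forall fun x ↦ ?_)
    rw [SchwartzMap.smulLeftCLM_apply_apply (schrodingerSymbol_hasTemperateGrowth t), norm_smul,
      norm_schrodingerSymbol, one_mul]
  rw [h1, ← eLpNorm_two_fourier, FourierTransform.fourier_fourierInv_eq]

/-- Parseval moves the Fourier transform onto the Gaussian, whose transform is
(π/z)^{n/2}exp(-π²|x-y|²/z). The exponential has modulus at most 1 because Re(1/z) ≥ 0, so the bound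
involves only |z| and survives Re z → 0. -/
theorem norm_gaussian_pairing_le {n : ℕ} {z : ℂ} (hz : 0 < z.re)
    (f : 𝓢(EuclideanSpace ℝ (Fin n), ℂ)) (x : EuclideanSpace ℝ (Fin n)) :
    ‖∫ ξ, Complex.exp (-z * ‖ξ‖ ^ 2 + (-(2 * Real.pi * Complex.I)) * inner ℝ x ξ) *
        (𝓕⁻ f : 𝓢(EuclideanSpace ℝ (Fin n), ℂ)) ξ‖ ≤
      (Real.pi / ‖z‖) ^ ((n : ℝ) / 2) * ∫ y, ‖f y‖ := by
  have hA : Integrable (fun ξ : EuclideanSpace ℝ (Fin n) ↦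
      Complex.exp (-z * ‖ξ‖ ^ 2 + (2 * Real.pi * Complex.I) * inner ℝ x ξ)) :=
    GaussianFourier.integrable_cexp_neg_mul_sq_norm_add hz _ _
  have key : ∀ y, ‖𝓕 (fun ξ : EuclideanSpace ℝ (Fin n) ↦
      Complex.exp (-z * ‖ξ‖ ^ 2 + (2 * Real.pi * Complex.I) * inner ℝ x ξ)) y‖ ≤
      (Real.pi / ‖z‖) ^ ((n : ℝ) / 2) := by
    intro y
    have h1 : 𝓕 (fun ξ : EuclideanSpace ℝ (Fin n) ↦
        Complex.exp (-z * ‖ξ‖ ^ 2 + (2 * Real.pi * Complex.I) * inner ℝ x ξ)) y =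
        ∫ ξ : EuclideanSpace ℝ (Fin n),
          Complex.exp (-z * ‖ξ‖ ^ 2 + (2 * Real.pi * Complex.I) * inner ℝ (x - y) ξ) := by
      rw [Real.fourier_eq']
      congr 1
      ext ξ
      rw [smul_eq_mul, ← Complex.exp_add, inner_sub_left, real_inner_comm y ξ]
      congr 1
      push_cast
      ring
    rw [h1, GaussianFourier.integral_cexp_neg_mul_sq_norm_add hz, norm_mul]
    have h2 : ‖((Real.pi : ℂ) / z) ^ (Module.finrank ℝ (EuclideanSpace ℝ (Fin n)) / 2 : ℂ)‖ =
        (Real.pi / ‖z‖) ^ ((n : ℝ) / 2) := by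
      have : (Module.finrank ℝ (EuclideanSpace ℝ (Fin n)) / 2 : ℂ) = (((n : ℝ) / 2 : ℝ) : ℂ) := by
        simp
      rw [this, Complex.norm_cpow_real, norm_div, Complex.norm_real, Real.norm_of_nonneg
        Real.pi_pos.le]
    rw [h2]
    refine mul_le_of_le_one_right (by positivity) ?_
    rw [Complex.norm_exp]
    refine Real.exp_le_one_iff.2 ?_
    have h3 : (2 * Real.pi * Complex.I) ^ 2 * (‖x - y‖ : ℂ) ^ 2 / (4 * z) =
        ((-(Real.pi ^ 2 * ‖x - y‖ ^ 2) : ℝ) : ℂ) * z⁻¹ := by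
      rw [mul_pow, Complex.I_sq]
      push_cast
      ring
    rw [h3, Complex.re_ofReal_mul, Complex.inv_re]
    have : 0 ≤ z.re / Complex.normSq z := div_nonneg hz.le (Complex.normSq_nonneg _)
    have : 0 ≤ Real.pi ^ 2 * ‖x - y‖ ^ 2 := by positivity
    nlinarith
  have h4 : ∫ ξ, Complex.exp (-z * ‖ξ‖ ^ 2 + (-(2 * Real.pi * Complex.I)) * inner ℝ x ξ) *
        (𝓕⁻ f : 𝓢(EuclideanSpace ℝ (Fin n), ℂ)) ξ =
      ∫ y, 𝓕 (fun ξ : EuclideanSpace ℝ (Fin n) ↦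
        Complex.exp (-z * ‖ξ‖ ^ 2 + (2 * Real.pi * Complex.I) * inner ℝ x ξ)) y * f y := by
    have h5 := VectorFourier.integral_bilin_fourierIntegral_eq_flip (μ := volume) (ν := volume)
      (ContinuousLinearMap.mul ℂ ℂ)
      (L := innerₗ (EuclideanSpace ℝ (Fin n))) Real.continuous_fourierChar
      continuous_inner hA (f.integrable (μ := volume))
    have h6 : ∫ y, 𝓕 (fun ξ : EuclideanSpace ℝ (Fin n) ↦
        Complex.exp (-z * ‖ξ‖ ^ 2 + (2 * Real.pi * Complex.I) * inner ℝ x ξ)) y * f y =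
        ∫ ξ, Complex.exp (-z * ‖ξ‖ ^ 2 + (2 * Real.pi * Complex.I) * inner ℝ x ξ) *
          𝓕 (f : EuclideanSpace ℝ (Fin n) → ℂ) ξ := by
      simpa using! h5
    rw [h6, ← integral_neg_eq_self]
    congr 1
    ext ξ
    rw [SchwartzMap.fourierInv_coe, Real.fourierInv_eq_fourier_neg, neg_neg, norm_neg,
      inner_neg_right]
    congr 2
    push_cast
    ring
  rw [h4, ← integral_const_mul]
  refine norm_integral_le_of_norm_le (f.integrable.norm.const_mul _) (.of_forall fun y ↦ ?_)
  rw [norm_mul]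
  exact mul_le_mul_of_nonneg_right (key y) (norm_nonneg _)

/-- The dispersive estimate on Schwartz functions. -/
theorem norm_schrodingerTest_le {n : ℕ} {t : ℝ} (ht : t ≠ 0)
    (f : 𝓢(EuclideanSpace ℝ (Fin n), ℂ)) (x : EuclideanSpace ℝ (Fin n)) :
    ‖schrodingerTest t f x‖ ≤ |t| ^ (-((n : ℝ) / 2)) * ∫ y, ‖f y‖ := by
  let h : 𝓢(EuclideanSpace ℝ (Fin n), ℂ) := 𝓕⁻ f
  -- The term ε > 0 turns the oscillating symbol into an integrable Gaussian; ε → 0 is then taken by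
  -- dominated convergence.
  let z : ℝ → ℂ := fun ε ↦ 4 * Real.pi ^ 2 * (ε + t * Complex.I)
  have hzc : Continuous z := by fun_prop
  let F : ℝ → EuclideanSpace ℝ (Fin n) → ℂ := fun ε ξ ↦
    Complex.exp (-z ε * ‖ξ‖ ^ 2 + (-(2 * Real.pi * Complex.I)) * inner ℝ x ξ) * h ξ
  have hz_re : ∀ ε, (z ε).re = 4 * Real.pi ^ 2 * ε := fun ε ↦ by
    have : z ε = ((4 * Real.pi ^ 2 : ℝ) : ℂ) * (ε + t * Complex.I) := by simp [z]
    rw [this, Complex.re_ofReal_mul]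
    simp
  have hz_im : ∀ ε, (z ε).im = 4 * Real.pi ^ 2 * t := fun ε ↦ by
    have : z ε = ((4 * Real.pi ^ 2 : ℝ) : ℂ) * (ε + t * Complex.I) := by simp [z]
    rw [this, Complex.im_ofReal_mul]
    simp
  have h0 : schrodingerTest t f x = ∫ ξ, F 0 ξ := by
    rw [schrodingerTest, SchwartzMap.fourier_coe, Real.fourier_eq']
    congr 1
    ext ξ
    rw [SchwartzMap.smulLeftCLM_apply_apply (schrodingerSymbol_hasTemperateGrowth t),
      schrodingerSymbol, smul_eq_mul, smul_eq_mul, ← mul_assoc, ← Complex.exp_add,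
      real_inner_comm x ξ]
    simp only [F, z]
    congr 2
    push_cast
    ring
  have hlim : Filter.Tendsto (fun ε ↦ ∫ ξ, F ε ξ) (nhdsWithin 0 (Ioi 0)) (nhds (∫ ξ, F 0 ξ)) := by
    refine tendsto_integral_filter_of_dominated_convergence (fun ξ ↦ ‖h ξ‖) ?_ ?_
      h.integrable.norm ?_
    · refine .of_forall fun ε ↦ Continuous.aestronglyMeasurable ?_
      exact (by fun_prop : Continuous fun ξ : EuclideanSpace ℝ (Fin n) ↦
        Complex.exp (-z ε * ‖ξ‖ ^ 2 + (-(2 * Real.pi * Complex.I)) * inner ℝ x ξ)).mul h.continuous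
    · filter_upwards [self_mem_nhdsWithin] with ε hε
      refine .of_forall fun ξ ↦ ?_
      rw [norm_mul]
      refine mul_le_of_le_one_left (norm_nonneg _) ?_
      rw [Complex.norm_exp, Real.exp_le_one_iff, Complex.add_re, neg_mul, Complex.neg_re]
      have h1 : (z ε * (‖ξ‖ : ℂ) ^ 2).re = 4 * Real.pi ^ 2 * ε * ‖ξ‖ ^ 2 := by
        rw [← Complex.ofReal_pow, Complex.re_mul_ofReal, hz_re]
      have h2 : (-(2 * Real.pi * Complex.I) * (inner ℝ x ξ : ℂ)).re = 0 := by
        rw [Complex.re_mul_ofReal]; simp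
      rw [h1, h2]
      have : (0 : ℝ) < ε := hε
      have : 0 ≤ 4 * Real.pi ^ 2 * ε * ‖ξ‖ ^ 2 := by positivity
      linarith
    · refine .of_forall fun ξ ↦ ?_
      have : Continuous fun ε ↦ F ε ξ := by fun_prop
      exact (this.tendsto 0).mono_left nhdsWithin_le_nhds
  rw [h0]
  refine le_of_tendsto hlim.norm ?_
  filter_upwards [self_mem_nhdsWithin] with ε hε
  have hpos : 0 < (z ε).re := by
    rw [hz_re]
    have : (0 : ℝ) < ε := hε
    positivity
  refine (norm_gaussian_pairing_le hpos f x).trans ?_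
  refine mul_le_mul_of_nonneg_right ?_ (integral_nonneg fun _ ↦ norm_nonneg _)
  -- The imaginary part alone bounds |z| below uniformly in ε; replacing 4π² by π leaves constant 1
  -- in the decay estimate.
  have hz1 : Real.pi * |t| ≤ ‖z ε‖ := by
    refine le_trans ?_ (Complex.abs_im_le_norm _)
    rw [hz_im, abs_mul, abs_of_pos (by positivity : 0 < 4 * Real.pi ^ 2)]
    refine mul_le_mul_of_nonneg_right ?_ (abs_nonneg _)
    nlinarith [Real.pi_gt_three]
  have htp : 0 < |t| := abs_pos.2 ht
  rw [Real.rpow_neg (abs_nonneg _), ← Real.inv_rpow (abs_nonneg _)]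
  refine Real.rpow_le_rpow (by positivity) ?_ (by positivity)
  rw [div_le_iff₀ (lt_of_lt_of_le (by positivity) hz1), inv_mul_eq_div, le_div_iff₀ htp]
  exact hz1

theorem enorm_schrodingerTest_le {n : ℕ} {t : ℝ} (ht : t ≠ 0)
    (f : 𝓢(EuclideanSpace ℝ (Fin n), ℂ)) (x : EuclideanSpace ℝ (Fin n)) :
    ‖schrodingerTest t f x‖ₑ ≤ ENNReal.ofReal (|t| ^ (-((n : ℝ) / 2))) * eLpNorm f 1 volume := by
  have h1 : eLpNorm f 1 volume = ENNReal.ofReal (∫ y, ‖f y‖) := by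
    rw [eLpNorm_one_eq_lintegral_enorm, ofReal_integral_norm_eq_lintegral_enorm f.integrable]
  rw [h1, ← ENNReal.ofReal_mul (by positivity), ← ofReal_norm]
  exact ENNReal.ofReal_le_ofReal (norm_schrodingerTest_le ht f x)

/-! ### Norms of two-sided sequences -/

/-- The `ℓ^q` norm of a two-sided sequence. -/
noncomputable def seqNorm (q : ℝ≥0∞) (a : ℤ → ℝ≥0∞) : ℝ≥0∞ :=
  if q = ∞ then ⨆ j, a j else (∑' j, a j ^ q.toReal) ^ (1 / q.toReal)

theorem seqNorm_top (a : ℤ → ℝ≥0∞) : seqNorm ∞ a = ⨆ j, a j := by simp [seqNorm]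

theorem seqNorm_of_ne_top {q : ℝ≥0∞} (hq : q ≠ ∞) (a : ℤ → ℝ≥0∞) :
    seqNorm q a = (∑' j, a j ^ q.toReal) ^ (1 / q.toReal) := by simp [seqNorm, hq]

theorem seqNorm_mono {q : ℝ≥0∞} {a b : ℤ → ℝ≥0∞} (h : ∀ j, a j ≤ b j) :
    seqNorm q a ≤ seqNorm q b := by
  by_cases hq : q = ∞
  · subst hq
    simp only [seqNorm_top]
    exact iSup_mono h
  · simp only [seqNorm_of_ne_top hq]
    refine ENNReal.rpow_le_rpow (ENNReal.tsum_le_tsum fun j ↦ ?_) (by positivity)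
    exact ENNReal.rpow_le_rpow (h j) ENNReal.toReal_nonneg

theorem seqNorm_comp_equiv (q : ℝ≥0∞) (a : ℤ → ℝ≥0∞) (e : ℤ ≃ ℤ) :
    seqNorm q (fun j ↦ a (e j)) = seqNorm q a := by
  by_cases hq : q = ∞
  · subst hq
    simp only [seqNorm_top]
    exact e.iSup_comp
  · simp only [seqNorm_of_ne_top hq]
    rw [e.tsum_eq (fun j ↦ a j ^ q.toReal)]

theorem seqNorm_const_mul {q : ℝ≥0∞} (hq0 : q ≠ 0) (c : ℝ≥0∞) (a : ℤ → ℝ≥0∞) :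
    seqNorm q (fun j ↦ c * a j) = c * seqNorm q a := by
  by_cases hq : q = ∞
  · subst hq
    simp only [seqNorm_top, ENNReal.mul_iSup]
  · have h0 : q.toReal ≠ 0 := (ENNReal.toReal_pos hq0 hq).ne'
    simp only [seqNorm_of_ne_top hq]
    simp_rw [ENNReal.mul_rpow_of_nonneg _ _ ENNReal.toReal_nonneg]
    rw [ENNReal.tsum_mul_left, ENNReal.mul_rpow_of_nonneg _ _ (by positivity), ← ENNReal.rpow_mul,
      mul_one_div_cancel h0, ENNReal.rpow_one]

theorem seqNorm_rpow_self {q : ℝ≥0∞} (hq0 : q ≠ 0) (hq : q ≠ ∞) (a : ℤ → ℝ≥0∞) :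
    seqNorm q a ^ q.toReal = ∑' j, a j ^ q.toReal := by
  rw [seqNorm_of_ne_top hq, ← ENNReal.rpow_mul,
    one_div_mul_cancel (ENNReal.toReal_pos hq0 hq).ne', ENNReal.rpow_one]

theorem le_seqNorm {q : ℝ≥0∞} (hq0 : q ≠ 0) (a : ℤ → ℝ≥0∞) (j : ℤ) : a j ≤ seqNorm q a := by
  by_cases hq : q = ∞
  · subst hq
    rw [seqNorm_top]
    exact le_iSup a j
  · rw [← ENNReal.rpow_le_rpow_iff (ENNReal.toReal_pos hq0 hq), seqNorm_rpow_self hq0 hq]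
    exact ENNReal.le_tsum (f := fun j ↦ a j ^ q.toReal) j

/-- Every term is at most the norm, so s-1 of the powers can be pulled out of the sum. This is what
keeps the power nonlinearity in the same second Lorentz index q. -/
theorem seqNorm_rpow_le {q : ℝ≥0∞} (hq0 : q ≠ 0) (a : ℤ → ℝ≥0∞) {s : ℝ} (hs : 1 ≤ s) :
    seqNorm q (fun j ↦ a j ^ s) ≤ seqNorm q a ^ s := by
  by_cases hq : q = ∞
  · subst hq
    rw [seqNorm_top]
    exact iSup_le fun j ↦ ENNReal.rpow_le_rpow (le_seqNorm hq0 a j) (by linarith)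
  · have hqp := ENNReal.toReal_pos hq0 hq
    have hs1 : 0 ≤ (s - 1) * q.toReal := mul_nonneg (by linarith) hqp.le
    rw [← ENNReal.rpow_le_rpow_iff hqp, seqNorm_rpow_self hq0 hq, ← ENNReal.rpow_mul,
      show s * q.toReal = (s - 1) * q.toReal + q.toReal by ring,
      ENNReal.rpow_add_of_nonneg _ _ hs1 hqp.le]
    conv_rhs => rw [seqNorm_rpow_self hq0 hq, ← ENNReal.tsum_mul_left]
    refine ENNReal.tsum_le_tsum fun j ↦ ?_
    rw [← ENNReal.rpow_mul, show s * q.toReal = (s - 1) * q.toReal + q.toReal by ring,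
      ENNReal.rpow_add_of_nonneg _ _ hs1 hqp.le]
    gcongr
    exact le_seqNorm hq0 a j

/-- Minkowski's integral inequality for `ℓ^q`-valued functions. -/
theorem seqNorm_lintegral_le {X : Type*} [MeasurableSpace X] {ν : Measure X} {q : ℝ≥0∞}
    (hq1 : 1 < q) {φ : ℤ → X → ℝ≥0∞} (hφ : ∀ j, AEMeasurable (φ j) ν) {m : X → ℝ≥0∞}
    (hm : ∀ᵐ τ ∂ν, seqNorm q (fun j ↦ φ j τ) ≤ m τ) :
    seqNorm q (fun j ↦ ∫⁻ τ, φ j τ ∂ν) ≤ ∫⁻ τ, m τ ∂ν := by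
  have hq0 : q ≠ 0 := (zero_lt_one.trans hq1).ne'
  have hle : ∀ j, ∫⁻ τ, φ j τ ∂ν ≤ ∫⁻ τ, m τ ∂ν := fun j ↦ by
    refine lintegral_mono_ae ?_
    filter_upwards [hm] with τ hτ
    exact (le_seqNorm hq0 (fun j ↦ φ j τ) j).trans hτ
  by_cases hq : q = ∞
  · subst hq
    rw [seqNorm_top]
    exact iSup_le hle
  have hqp := ENNReal.toReal_pos hq0 hq
  have hq1' : 1 < q.toReal := by
    rw [← ENNReal.toReal_one]
    exact (ENNReal.toReal_lt_toReal ENNReal.one_ne_top hq).2 hq1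
  set Q := q.toReal with hQ
  by_cases hM : ∫⁻ τ, m τ ∂ν = ∞
  · rw [hM]; exact le_top
  set I : ℤ → ℝ≥0∞ := fun j ↦ ∫⁻ τ, φ j τ ∂ν with hI
  have hItop : ∀ j, I j ≠ ∞ := fun j ↦ ((hle j).trans_lt (lt_top_iff_ne_top.2 hM)).ne
  rw [← ENNReal.rpow_le_rpow_iff hqp, seqNorm_rpow_self hq0 hq, ENNReal.tsum_eq_iSup_sum]
  refine iSup_le fun J ↦ ?_
  -- A finite partial sum is known to be finite, which permits dividing by S^{1/Q'} at the end, Q'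
  -- being the conjugate exponent.
  set S := ∑ j ∈ J, I j ^ Q with hS
  have hStop : S ≠ ∞ := ENNReal.sum_ne_top.2 fun j _ ↦
    ENNReal.rpow_ne_top_of_nonneg hqp.le (hItop j)
  by_cases hS0 : S = 0
  · rw [hS0]; exact zero_le
  have hconj : (Q.conjExponent).HolderConjugate Q := (Real.HolderConjugate.conjExponent hq1').symm
  have hpe : (Q - 1) * Q.conjExponent = Q := by
    rw [Real.conjExponent, mul_div_cancel₀ _ (by linarith)]
  -- Write I_j^Q = I_j^{Q-1}∫φ_j, exchange sum and integral, and apply Hölder in j under the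
  -- integral.
  have h1 : S ≤ S ^ (1 / Q.conjExponent) * ∫⁻ τ, m τ ∂ν := by
    have e1 : S = ∫⁻ τ, ∑ j ∈ J, I j ^ (Q - 1) * φ j τ ∂ν := by
      rw [lintegral_finsetSum' _ fun j _ ↦ (hφ j).const_mul _, hS]
      refine Finset.sum_congr rfl fun j _ ↦ ?_
      rw [lintegral_const_mul'' _ (hφ j)]
      change I j ^ Q = I j ^ (Q - 1) * I j
      conv_rhs => rw [← ENNReal.rpow_one (I j), ← ENNReal.rpow_mul, one_mul]
      rw [← ENNReal.rpow_add_of_nonneg _ _ (by linarith) zero_le_one]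
      congr 1
      ring
    conv_lhs => rw [e1]
    rw [← lintegral_const_mul' _ _ (ENNReal.rpow_ne_top_of_nonneg
      (by have := hconj.pos; positivity) hStop)]
    refine lintegral_mono_ae ?_
    filter_upwards [hm] with τ hτ
    refine (ENNReal.inner_le_Lp_mul_Lq J _ _ hconj).trans ?_
    refine mul_le_mul' (le_of_eq ?_) ?_
    · rw [hS]
      congr 1
      refine Finset.sum_congr rfl fun j _ ↦ ?_
      rw [← ENNReal.rpow_mul, hpe]
    · refine le_trans ?_ hτ
      rw [seqNorm_of_ne_top hq]
      exact ENNReal.rpow_le_rpow (ENNReal.sum_le_tsum J) (by positivity)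
  have h2 : S = S ^ (1 / Q.conjExponent) * S ^ (1 / Q) := by
    rw [← ENNReal.rpow_add _ _ hS0 hStop, one_div, one_div, hconj.inv_add_inv_eq_one,
      ENNReal.rpow_one]
  have h3 : S ^ (1 / Q) ≤ ∫⁻ τ, m τ ∂ν := by
    have hc0 : S ^ (1 / Q.conjExponent) ≠ 0 := by
      simp [ENNReal.rpow_eq_zero_iff, hS0, hStop]
    have hct : S ^ (1 / Q.conjExponent) ≠ ∞ :=
      ENNReal.rpow_ne_top_of_nonneg (by have := hconj.pos; positivity) hStop
    refine (ENNReal.mul_le_mul_iff_right hc0 hct).1 ?_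
    rw [← h2]
    exact h1
  calc S = (S ^ (1 / Q)) ^ Q := by
        rw [← ENNReal.rpow_mul, one_div_mul_cancel hqp.ne', ENNReal.rpow_one]
    _ ≤ _ := ENNReal.rpow_le_rpow h3 hqp.le

/-- This is Minkowski's integral inequality for counting measure on a discrete index set. -/
theorem seqNorm_tsum_le {ι : Type*} {q : ℝ≥0∞} (hq1 : 1 < q) (φ : ι → ℤ → ℝ≥0∞) :
    seqNorm q (fun j ↦ ∑' i, φ i j) ≤ ∑' i, seqNorm q (φ i) := by
  let _ : MeasurableSpace ι := ⊤
  have h := seqNorm_lintegral_le (X := ι) (ν := Measure.count) hq1 (φ := fun j i ↦ φ i j)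
    (fun j ↦ measurable_from_top.aemeasurable) (m := fun i ↦ seqNorm q (φ i))
    (.of_forall fun i ↦ le_rfl)
  simpa [lintegral_count] using h

theorem seqNorm_add_le {q : ℝ≥0∞} (hq1 : 1 < q) (a b : ℤ → ℝ≥0∞) :
    seqNorm q (fun j ↦ a j + b j) ≤ seqNorm q a + seqNorm q b := by
  have h := seqNorm_tsum_le hq1 (fun i : Bool ↦ if i then a else b)
  simpa [tsum_fintype] using h

/-! ### Rearrangements and the dyadic form of the Lorentz quasi-norm -/

variable {n : ℕ}

theorem rearrangement_antitone (f : EuclideanSpace ℝ (Fin n) → ℂ) :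
    Antitone (rearrangement f) := fun _ _ h ↦
  iInf_mono fun _ ↦ iInf_mono' fun hs ↦ ⟨⟨hs.1, hs.2.trans (ENNReal.ofReal_le_ofReal h)⟩, le_rfl⟩

theorem lt_distribFun_of_lt_rearrangement {f : EuclideanSpace ℝ (Fin n) → ℂ} {t s : ℝ}
    (hs : 0 < s) (h : ENNReal.ofReal s < rearrangement f t) :
    ENNReal.ofReal t < distribFun f s := by
  by_contra! hc
  exact absurd (iInf₂_le s ⟨hs, hc⟩) (not_le.2 h)

/-- The defining infimum is attained in this sense: the set is the increasing union of {|f| > y_k}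
with y_k decreasing strictly to f*(t), and each of these has measure at most t. -/
theorem volume_rearrangement_lt_le (f : EuclideanSpace ℝ (Fin n) → ℂ) (t : ℝ) :
    volume {x | rearrangement f t < ‖f x‖ₑ} ≤ ENNReal.ofReal t := by
  by_cases htop : rearrangement f t = ∞
  · simp [htop]
  obtain ⟨y, hya, hy, hylim⟩ := exists_seq_strictAnti_tendsto' (lt_top_iff_ne_top.2 htop)
  have hset : {x | rearrangement f t < ‖f x‖ₑ} = ⋃ k, {x | y k < ‖f x‖ₑ} := by
    ext x
    simp only [mem_ofPred_eq, mem_iUnion]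
    constructor
    · intro h
      exact (hylim.eventually (gt_mem_nhds h)).exists
    · rintro ⟨k, hk⟩
      exact (hy k).1.trans hk
  have hmono : Monotone fun k ↦ {x | y k < ‖f x‖ₑ} := fun k l hkl x hx ↦
    lt_of_le_of_lt (hya.antitone hkl) hx
  rw [hset, hmono.measure_iUnion]
  refine iSup_le fun k ↦ ?_
  have hk := (hy k).1
  unfold rearrangement at hk
  simp only [iInf_lt_iff] at hk
  obtain ⟨s, hs, hsy⟩ := hk
  refine le_trans (measure_mono fun x hx ↦ ?_) hs.2
  have : ENNReal.ofReal s < ENNReal.ofReal ‖f x‖ := by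
    rw [ofReal_norm]
    exact hsy.trans hx
  exact (ENNReal.ofReal_lt_ofReal_iff_of_nonneg hs.1.le).1 this

theorem rearrangement_add_le {f g h : EuclideanSpace ℝ (Fin n) → ℂ}
    (hfg : ∀ x, ‖h x‖ ≤ ‖f x‖ + ‖g x‖) {s t : ℝ} (hs : 0 ≤ s) (ht : 0 ≤ t) :
    rearrangement h (s + t) ≤ rearrangement f s + rearrangement g t := by
  refine ENNReal.le_of_forall_pos_le_add fun ε hε hfin ↦ ?_
  have hε2 : (ε / 2 : ℝ≥0∞) ≠ 0 := by
    simpa using hε.ne'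
  have key : ∀ (k : EuclideanSpace ℝ (Fin n) → ℂ) (r : ℝ), rearrangement k r ≠ ∞ →
      ∃ l : ℝ, (0 < l ∧ distribFun k l ≤ ENNReal.ofReal r) ∧
        ENNReal.ofReal l < rearrangement k r + ε / 2 := by
    intro k r hk
    have : rearrangement k r < rearrangement k r + ε / 2 := ENNReal.lt_add_right hk hε2
    conv_lhs at this => unfold rearrangement
    simp only [iInf_lt_iff] at this
    obtain ⟨l, hl, hl'⟩ := this
    exact ⟨l, hl, hl'⟩
  obtain ⟨h1, h2⟩ := ENNReal.add_lt_top.1 hfin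
  obtain ⟨a, ha, ha'⟩ := key f s h1.ne
  obtain ⟨b, hb, hb'⟩ := key g t h2.ne
  have hab : distribFun h (a + b) ≤ ENNReal.ofReal (s + t) := by
    rw [ENNReal.ofReal_add hs ht]
    refine le_trans ?_ (add_le_add ha.2 hb.2)
    refine le_trans (measure_mono ?_) (measure_union_le _ _)
    intro x hx
    by_contra hc
    simp only [mem_union, mem_ofPred_eq, not_or, not_lt] at hc
    have hx' : a + b < ‖h x‖ := hx
    linarith [hfg x, hc.1, hc.2]
  calc rearrangement h (s + t) ≤ ENNReal.ofReal (a + b) :=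
        iInf₂_le (a + b) ⟨add_pos ha.1 hb.1, hab⟩
    _ = ENNReal.ofReal a + ENNReal.ofReal b := ENNReal.ofReal_add ha.1.le hb.1.le
    _ ≤ (rearrangement f s + ε / 2) + (rearrangement g t + ε / 2) := add_le_add ha'.le hb'.le
    _ = rearrangement f s + rearrangement g t + ε := by
        rw [add_add_add_comm, ENNReal.add_halves]

/-- The dyadic sequence `2^{j/p} f*(2^j)`. -/
noncomputable def dyadicSeq (p : ℝ) (f : EuclideanSpace ℝ (Fin n) → ℂ) (j : ℤ) : ℝ≥0∞ :=
  ENNReal.ofReal (((2 : ℝ) ^ j) ^ (1 / p)) * rearrangement f ((2 : ℝ) ^ j)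

theorem iUnion_Ico_two_zpow : ⋃ j : ℤ, Ico ((2 : ℝ) ^ j) (2 ^ (j + 1)) = Ioi 0 := by
  ext x
  simp only [mem_iUnion, mem_Ioi]
  constructor
  · rintro ⟨j, hj⟩
    exact lt_of_lt_of_le (by positivity) hj.1
  · exact fun hx ↦ exists_mem_Ico_zpow hx one_lt_two

theorem lintegral_Ioi_eq_tsum (F : ℝ → ℝ≥0∞) :
    ∫⁻ t in Ioi (0 : ℝ), F t = ∑' j : ℤ, ∫⁻ t in Ico ((2 : ℝ) ^ j) (2 ^ (j + 1)), F t := by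
  rw [← iUnion_Ico_two_zpow]
  refine lintegral_iUnion (fun _ ↦ measurableSet_Ico) ?_ _
  simpa [Order.succ_eq_add_one] using (zpow_right_strictMono₀ (one_lt_two : (1 : ℝ) < 2)).monotone.pairwise_disjoint_on_Ico_succ

theorem volume_Ico_two_zpow (j : ℤ) :
    volume (Ico ((2 : ℝ) ^ j) (2 ^ (j + 1))) = ENNReal.ofReal (2 ^ j) := by
  rw [Real.volume_Ico, zpow_add_one₀ two_ne_zero]
  congr 1
  ring

theorem weight_le_of_mem_Ico {p : ℝ} (hp : 0 < p) (f : EuclideanSpace ℝ (Fin n) → ℂ) {j : ℤ}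
    {t : ℝ} (ht : t ∈ Ico ((2 : ℝ) ^ j) (2 ^ (j + 1))) :
    ENNReal.ofReal (t ^ (1 / p)) * rearrangement f t ≤
      ENNReal.ofReal (2 ^ (1 / p)) * dyadicSeq p f j := by
  have h0 : (0 : ℝ) < 2 ^ j := by positivity
  rw [dyadicSeq, ← mul_assoc, ← ENNReal.ofReal_mul (by positivity),
    ← Real.mul_rpow (by positivity) h0.le]
  refine mul_le_mul' (ENNReal.ofReal_le_ofReal (Real.rpow_le_rpow (h0.le.trans ht.1) ?_
    (by positivity))) (rearrangement_antitone f ht.1)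
  rw [← zpow_one_add₀ two_ne_zero, add_comm]
  exact ht.2.le

theorem le_weight_of_mem_Ico {p : ℝ} (hp : 0 < p) (f : EuclideanSpace ℝ (Fin n) → ℂ) {j : ℤ}
    {t : ℝ} (ht : t ∈ Ico ((2 : ℝ) ^ j) (2 ^ (j + 1))) :
    dyadicSeq p f (j + 1) ≤
      ENNReal.ofReal (2 ^ (1 / p)) * (ENNReal.ofReal (t ^ (1 / p)) * rearrangement f t) := by
  have h0 : (0 : ℝ) < 2 ^ j := by positivity
  rw [dyadicSeq, ← mul_assoc, ← ENNReal.ofReal_mul (by positivity),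
    ← Real.mul_rpow (by positivity) (h0.le.trans ht.1)]
  refine mul_le_mul' (ENNReal.ofReal_le_ofReal (Real.rpow_le_rpow (by positivity) ?_
    (by positivity))) (rearrangement_antitone f ht.2.le)
  rw [zpow_add_one₀ two_ne_zero, mul_comm]
  exact mul_le_mul_of_nonneg_left ht.1 two_pos.le

/-- On [2^j, 2^{j+1}) the rearrangement is at most its value at the left endpoint, the power weight
changes by at most 2^{1/p}, and the dt/t mass is at most 1. -/
theorem lorentzNorm_le_seqNorm {p : ℝ} (hp : 0 < p) {q : ℝ≥0∞} (hq0 : q ≠ 0) :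
    ∃ C : ℝ≥0∞, C ≠ ∞ ∧ ∀ f : EuclideanSpace ℝ (Fin n) → ℂ,
      lorentzNorm p q f ≤ C * seqNorm q (dyadicSeq p f) := by
  by_cases hq : q = ∞
  · subst hq
    refine ⟨ENNReal.ofReal (2 ^ (1 / p)), ENNReal.ofReal_ne_top, fun f ↦ ?_⟩
    simp only [lorentzNorm, if_true]
    refine iSup₂_le fun t ht ↦ ?_
    obtain ⟨j, hj⟩ := exists_mem_Ico_zpow ht (one_lt_two : (1 : ℝ) < 2)
    refine (weight_le_of_mem_Ico hp f hj).trans ?_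
    gcongr
    exact le_seqNorm hq0 _ j
  have hqp := ENNReal.toReal_pos hq0 hq
  refine ⟨ENNReal.ofReal (q.toReal / p) ^ (1 / q.toReal) * ENNReal.ofReal (2 ^ (1 / p)),
    ENNReal.mul_ne_top (ENNReal.rpow_ne_top_of_nonneg (by positivity) ENNReal.ofReal_ne_top)
      ENNReal.ofReal_ne_top, fun f ↦ ?_⟩
  simp only [lorentzNorm, if_neg hq]
  rw [ENNReal.mul_rpow_of_nonneg _ _ (by positivity), mul_assoc]
  gcongr
  rw [← seqNorm_const_mul hq0, seqNorm_of_ne_top hq, lintegral_Ioi_eq_tsum]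
  refine ENNReal.rpow_le_rpow (ENNReal.tsum_le_tsum fun j ↦ ?_) (by positivity)
  have h0 : (0 : ℝ) < 2 ^ j := by positivity
  calc ∫⁻ t in Ico ((2 : ℝ) ^ j) (2 ^ (j + 1)),
        (ENNReal.ofReal (t ^ (1 / p)) * rearrangement f t) ^ q.toReal * ENNReal.ofReal (1 / t)
      ≤ ∫⁻ t in Ico ((2 : ℝ) ^ j) (2 ^ (j + 1)),
        (ENNReal.ofReal (2 ^ (1 / p)) * dyadicSeq p f j) ^ q.toReal *
          ENNReal.ofReal (1 / 2 ^ j) := by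
        refine setLIntegral_mono measurable_const fun t ht ↦ ?_
        refine mul_le_mul' (ENNReal.rpow_le_rpow (weight_le_of_mem_Ico hp f ht) hqp.le)
          (ENNReal.ofReal_le_ofReal (one_div_le_one_div_of_le h0 ht.1))
    _ = (ENNReal.ofReal (2 ^ (1 / p)) * dyadicSeq p f j) ^ q.toReal := by
        rw [setLIntegral_const, volume_Ico_two_zpow, mul_assoc,
          ← ENNReal.ofReal_mul (by positivity), one_div_mul_cancel h0.ne', ENNReal.ofReal_one,
          mul_one]

/-- By monotonicity, the values on [2^j, 2^{j+1}) dominate the one at the right endpoint, so the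
interval j controls the term j+1; hence the shift of index in the proof. The factor 2 appears
because the dt/t mass of the interval is only bounded below by 2^j/2^{j+1} = 1/2. -/
theorem seqNorm_le_lorentzNorm {p : ℝ} (hp : 0 < p) {q : ℝ≥0∞} (hq0 : q ≠ 0) :
    ∃ C : ℝ≥0∞, C ≠ ∞ ∧ ∀ f : EuclideanSpace ℝ (Fin n) → ℂ,
      seqNorm q (dyadicSeq p f) ≤ C * lorentzNorm p q f := by
  by_cases hq : q = ∞
  · subst hq
    refine ⟨1, ENNReal.one_ne_top, fun f ↦ ?_⟩
    simp only [lorentzNorm, if_true, seqNorm_top, one_mul]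
    exact iSup_le fun j ↦ le_iSup₂ (f := fun (t : ℝ) (_ : 0 < t) ↦
      ENNReal.ofReal (t ^ (1 / p)) * rearrangement f t) (2 ^ j) (by positivity)
  have hqp := ENNReal.toReal_pos hq0 hq
  refine ⟨ENNReal.ofReal (2 ^ (1 / p)) * (2 : ℝ≥0∞) ^ (1 / q.toReal) *
      (ENNReal.ofReal (q.toReal / p) ^ (1 / q.toReal))⁻¹,
    ENNReal.mul_ne_top (ENNReal.mul_ne_top ENNReal.ofReal_ne_top
      (ENNReal.rpow_ne_top_of_nonneg (by positivity) ENNReal.ofNat_ne_top)) ?_, fun f ↦ ?_⟩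
  · rw [ENNReal.inv_ne_top, ne_eq, ENNReal.rpow_eq_zero_iff]
    have : ENNReal.ofReal (q.toReal / p) ≠ 0 := by
      rw [ne_eq, ENNReal.ofReal_eq_zero, not_le]
      positivity
    simp [this]
  simp only [lorentzNorm, if_neg hq]
  rw [ENNReal.mul_rpow_of_nonneg _ _ (by positivity), mul_assoc (ENNReal.ofReal _ * _),
    ← mul_assoc (_⁻¹), ENNReal.inv_mul_cancel, one_mul]
  rotate_left
  · have : ENNReal.ofReal (q.toReal / p) ≠ 0 := by
      rw [ne_eq, ENNReal.ofReal_eq_zero, not_le]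
      positivity
    simp [ENNReal.rpow_eq_zero_iff, this]
  · exact ENNReal.rpow_ne_top_of_nonneg (by positivity) ENNReal.ofReal_ne_top
  rw [← seqNorm_comp_equiv q (dyadicSeq p f) (Equiv.addRight 1), mul_assoc,
    ← ENNReal.mul_rpow_of_nonneg _ _ (by positivity : 0 ≤ 1 / q.toReal), lintegral_Ioi_eq_tsum,
    ← ENNReal.tsum_mul_left]
  have hmain : seqNorm q (fun j ↦ dyadicSeq p f (Equiv.addRight 1 j)) ≤
      seqNorm q (fun j ↦ ENNReal.ofReal (2 ^ (1 / p)) *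
        (2 * ∫⁻ t in Ico ((2 : ℝ) ^ j) (2 ^ (j + 1)),
          (ENNReal.ofReal (t ^ (1 / p)) * rearrangement f t) ^ q.toReal *
            ENNReal.ofReal (1 / t)) ^ (1 / q.toReal)) := by
    refine seqNorm_mono fun j ↦ ?_
    have h0 : (0 : ℝ) < 2 ^ j := by positivity
    have hc0 : ENNReal.ofReal (2 ^ (1 / p)) ≠ 0 := by
      rw [ne_eq, ENNReal.ofReal_eq_zero, not_le]; positivity
    rw [mul_comm, ← ENNReal.div_le_iff_le_mul (.inl hc0) (.inl ENNReal.ofReal_ne_top), Equiv.coe_addRight,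
      one_div q.toReal, ENNReal.le_rpow_inv_iff hqp]
    calc (dyadicSeq p f (j + 1) / ENNReal.ofReal (2 ^ (1 / p))) ^ q.toReal
        = 2 * ∫⁻ _ in Ico ((2 : ℝ) ^ j) (2 ^ (j + 1)),
          (dyadicSeq p f (j + 1) / ENNReal.ofReal (2 ^ (1 / p))) ^ q.toReal *
            ENNReal.ofReal (1 / 2 ^ (j + 1)) := by
          rw [setLIntegral_const, volume_Ico_two_zpow, mul_assoc,
            ← ENNReal.ofReal_mul (by positivity), mul_comm (2 : ℝ≥0∞), mul_assoc,
            ← ENNReal.ofReal_ofNat 2, ← ENNReal.ofReal_mul (by positivity)]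
          have : (1 / 2 ^ (j + 1) * 2 ^ j * 2 : ℝ) = 1 := by
            rw [zpow_add_one₀ two_ne_zero]
            field_simp
          rw [this, ENNReal.ofReal_one, mul_one]
      _ ≤ _ := by
          gcongr 2 * ?_
          refine setLIntegral_mono' measurableSet_Ico fun t ht ↦ ?_
          have ht0 : 0 < t := h0.trans_le ht.1
          refine mul_le_mul' (ENNReal.rpow_le_rpow ?_ hqp.le)
            (ENNReal.ofReal_le_ofReal (one_div_le_one_div_of_le ht0 ht.2.le))
          rw [ENNReal.div_le_iff_le_mul (.inl hc0) (.inl ENNReal.ofReal_ne_top), mul_comm]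
          exact le_weight_of_mem_Ico hp f ht
  refine hmain.trans ?_
  rw [seqNorm_const_mul hq0, seqNorm_of_ne_top hq]
  gcongr with j
  rw [← ENNReal.rpow_mul, one_div_mul_cancel hqp.ne', ENNReal.rpow_one]

/-- From h*(2^{j+1}) ≤ f*(2^j) + g*(2^j), shifting the index costs 2^{1/p}, and the triangle
inequality in ℓ^q does the rest. -/
theorem lorentzNorm_add_le {p : ℝ} (hp : 0 < p) {q : ℝ≥0∞} (hq1 : 1 < q) :
    ∃ C : ℝ≥0∞, C ≠ ∞ ∧ ∀ f g h : EuclideanSpace ℝ (Fin n) → ℂ,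
      (∀ x, ‖h x‖ ≤ ‖f x‖ + ‖g x‖) →
      lorentzNorm p q h ≤ C * (lorentzNorm p q f + lorentzNorm p q g) := by
  have hq0 : q ≠ 0 := (zero_lt_one.trans hq1).ne'
  obtain ⟨C₁, hC₁, h₁⟩ := lorentzNorm_le_seqNorm (n := n) hp hq0
  obtain ⟨C₂, hC₂, h₂⟩ := seqNorm_le_lorentzNorm (n := n) hp hq0
  refine ⟨C₁ * ENNReal.ofReal (2 ^ (1 / p)) * C₂, ENNReal.mul_ne_top (ENNReal.mul_ne_top hC₁
    ENNReal.ofReal_ne_top) hC₂, fun f g h hfg ↦ ?_⟩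
  calc lorentzNorm p q h ≤ C₁ * seqNorm q (dyadicSeq p h) := h₁ h
    _ = C₁ * seqNorm q (fun j ↦ dyadicSeq p h (Equiv.addRight 1 j)) := by
        rw [seqNorm_comp_equiv]
    _ ≤ C₁ * seqNorm q (fun j ↦ ENNReal.ofReal (2 ^ (1 / p)) *
          (dyadicSeq p f j + dyadicSeq p g j)) := by
        refine mul_le_mul' le_rfl (seqNorm_mono fun j ↦ ?_)
        have h0 : (0 : ℝ) < 2 ^ j := by positivity
        rw [Equiv.coe_addRight, dyadicSeq, dyadicSeq, dyadicSeq, ← mul_add, ← mul_assoc,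
          ← ENNReal.ofReal_mul (by positivity), ← Real.mul_rpow (by positivity) h0.le,
          zpow_add_one₀ two_ne_zero, mul_comm ((2 : ℝ) ^ j) 2]
        gcongr
        rw [two_mul]
        exact rearrangement_add_le hfg h0.le h0.le
    _ ≤ C₁ * (ENNReal.ofReal (2 ^ (1 / p)) *
          (C₂ * lorentzNorm p q f + C₂ * lorentzNorm p q g)) := by
        rw [seqNorm_const_mul hq0]
        gcongr
        exact (seqNorm_add_le hq1 _ _).trans (add_le_add (h₂ f) (h₂ g))
    _ = _ := by rw [← mul_add]; ring

/-! ### Functionals bounded on L¹ ∩ L² are given by functions -/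

/-- The weight `(1 + |x|²)^s`. -/
noncomputable def japaneseWeight (s : ℝ) (x : EuclideanSpace ℝ (Fin n)) : ℂ :=
  (((1 + ‖x‖ ^ 2) ^ s : ℝ) : ℂ)

theorem japaneseWeight_hasTemperateGrowth (s : ℝ) :
    (japaneseWeight s : EuclideanSpace ℝ (Fin n) → ℂ).HasTemperateGrowth :=
  Function.HasTemperateGrowth.comp (f := fun x : EuclideanSpace ℝ (Fin n) ↦ (1 + ‖x‖ ^ 2) ^ s)
    (g := fun y : ℝ ↦ (y : ℂ)) (by fun_prop)
    (Function.hasTemperateGrowth_one_add_norm_sq_rpow _ s)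

theorem japaneseWeight_neg_mul (s : ℝ) (x : EuclideanSpace ℝ (Fin n)) :
    japaneseWeight (-s) x * japaneseWeight s x = 1 := by
  have : (0 : ℝ) < 1 + ‖x‖ ^ 2 := by positivity
  rw [japaneseWeight, japaneseWeight, ← Complex.ofReal_mul, ← Real.rpow_add this]
  simp

theorem norm_japaneseWeight_neg_le {s : ℝ} (hs : 0 ≤ s) (x : EuclideanSpace ℝ (Fin n)) :
    ‖japaneseWeight (-s) x‖ ≤ 1 := by
  rw [japaneseWeight, Complex.norm_real, Real.norm_of_nonneg (by positivity)]
  exact Real.rpow_le_one_of_one_le_of_nonpos (by nlinarith [sq_nonneg ‖x‖]) (by linarith)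

theorem continuous_japaneseWeight (s : ℝ) :
    Continuous (japaneseWeight s : EuclideanSpace ℝ (Fin n) → ℂ) :=
  (japaneseWeight_hasTemperateGrowth s).1.continuous

/-- The weight is at most 1, so its square is at most the weight itself, which is integrable since
its decay exponent n+1 exceeds n. -/
theorem memLp_japaneseWeight :
    MemLp (japaneseWeight (-(((n : ℝ) + 1) / 2)) : EuclideanSpace ℝ (Fin n) → ℂ) 2 volume := by
  have hc : AEStronglyMeasurable
      (japaneseWeight (-(((n : ℝ) + 1) / 2)) : EuclideanSpace ℝ (Fin n) → ℂ) volume :=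
    (continuous_japaneseWeight _).aestronglyMeasurable
  rw [memLp_two_iff_integrable_sq_norm hc]
  have hi : Integrable (fun x : EuclideanSpace ℝ (Fin n) ↦
      (1 + ‖x‖ ^ 2) ^ (-((n : ℝ) + 1) / 2)) volume :=
    integrable_rpow_neg_one_add_norm_sq (by simp)
  refine hi.mono' (hc.norm.pow 2) (.of_forall fun x ↦ ?_)
  rw [Real.norm_of_nonneg (by positivity), sq]
  refine (mul_le_of_le_one_left (norm_nonneg _)
    (norm_japaneseWeight_neg_le (by positivity) x)).trans ?_
  rw [japaneseWeight, Complex.norm_real, Real.norm_of_nonneg (by positivity), neg_div]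

theorem eLpNorm_two_japaneseWeight_mul_le {s : ℝ} (hs : 0 ≤ s)
    (h : EuclideanSpace ℝ (Fin n) → ℂ) :
    eLpNorm (fun x ↦ japaneseWeight (-s) x * h x) 2 volume ≤ eLpNorm h 2 volume := by
  refine eLpNorm_mono fun x ↦ ?_
  rw [norm_mul]
  exact mul_le_of_le_one_left (norm_nonneg _) (norm_japaneseWeight_neg_le hs x)

theorem eLpNorm_one_japaneseWeight_mul_le {h : EuclideanSpace ℝ (Fin n) → ℂ}
    (hh : AEStronglyMeasurable h volume) :
    eLpNorm (fun x ↦ japaneseWeight (-(((n : ℝ) + 1) / 2)) x * h x) 1 volume ≤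
      eLpNorm (japaneseWeight (-(((n : ℝ) + 1) / 2)) : EuclideanSpace ℝ (Fin n) → ℂ) 2 volume *
        eLpNorm h 2 volume := by
  have := eLpNorm_smul_le_mul_eLpNorm (p := 2) (q := 2) (r := 1) hh
    (continuous_japaneseWeight (-(((n : ℝ) + 1) / 2))).aestronglyMeasurable
  exact this

set_option maxHeartbeats 1000000 in
/-- A linear functional on Schwartz functions that is bounded in `L¹ ∩ L²` is a tempered
distribution given by a measurable function, and it can be evaluated approximately at bounded
functions with bounded support. -/
theorem exists_represents_of_bounded (T : 𝓢(EuclideanSpace ℝ (Fin n), ℂ) →ₗ[ℂ] ℂ) (M : ℝ)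
    (hT : ∀ f : 𝓢(EuclideanSpace ℝ (Fin n), ℂ), eLpNorm f 1 volume ≤ 1 →
      eLpNorm f 2 volume ≤ 1 → ‖T f‖ ≤ M) :
    ∃ (g : EuclideanSpace ℝ (Fin n) → ℂ) (T' : 𝓢'(EuclideanSpace ℝ (Fin n), ℂ)),
      StronglyMeasurable g ∧ (∀ f, T' f = T f) ∧ Represents g T' ∧
      ∀ (φ : EuclideanSpace ℝ (Fin n) → ℂ) (B R : ℝ), AEStronglyMeasurable φ volume →
        (∀ x, ‖φ x‖ ≤ B) → (∀ x, R < ‖x‖ → φ x = 0) → Integrable (fun x ↦ φ x * g x) ∧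
        ∀ ε : ℝ, 0 < ε → ∃ f : 𝓢(EuclideanSpace ℝ (Fin n), ℂ),
          eLpNorm (fun x ↦ f x - φ x) 1 volume ≤ ENNReal.ofReal ε ∧
          eLpNorm (fun x ↦ f x - φ x) 2 volume ≤ ENNReal.ofReal ε ∧
          ‖T f - ∫ x, φ x * g x‖ ≤ ε := by
  let E := EuclideanSpace ℝ (Fin n)
  -- With this s, multiplication by (1+|x|²)^{-s} maps L² boundedly into L¹ ∩ L². Thus T composed
  -- with the weight is L²-bounded, and Riesz representation applies to it; undoing the weight gives
  -- g.
  set s : ℝ := ((n : ℝ) + 1) / 2 with hs_def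
  have hs : 0 ≤ s := by positivity
  let W : 𝓢(E, ℂ) →L[ℂ] 𝓢(E, ℂ) := SchwartzMap.smulLeftCLM ℂ (japaneseWeight (-s))
  let W' : 𝓢(E, ℂ) →L[ℂ] 𝓢(E, ℂ) := SchwartzMap.smulLeftCLM ℂ (japaneseWeight s)
  have hW : ∀ (h : 𝓢(E, ℂ)) x, W h x = japaneseWeight (-s) x * h x := fun h x ↦
    SchwartzMap.smulLeftCLM_apply_apply (japaneseWeight_hasTemperateGrowth _) h x
  have hW' : ∀ (h : 𝓢(E, ℂ)) x, W' h x = japaneseWeight s x * h x := fun h x ↦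
    SchwartzMap.smulLeftCLM_apply_apply (japaneseWeight_hasTemperateGrowth _) h x
  have hWW' : ∀ h : 𝓢(E, ℂ), W (W' h) = h := fun h ↦ by
    ext x
    rw [hW, hW', ← mul_assoc, japaneseWeight_neg_mul, one_mul]
  set K₀ : ℝ≥0∞ := eLpNorm (japaneseWeight (-s) : E → ℂ) 2 volume with hK₀
  have hK₀top : K₀ ≠ ∞ := memLp_japaneseWeight.2.ne
  set K : ℝ := max 1 K₀.toReal with hK
  have hK1 : 1 ≤ K := le_max_left _ _
  have hK₀K : K₀ ≤ ENNReal.ofReal K :=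
    (ENNReal.ofReal_toReal hK₀top).symm.le.trans (ENNReal.ofReal_le_ofReal (le_max_right _ _))
  have h1W : ∀ h : E → ℂ, AEStronglyMeasurable h volume →
      eLpNorm (fun x ↦ japaneseWeight (-s) x * h x) 1 volume ≤
        ENNReal.ofReal K * eLpNorm h 2 volume := fun h hh ↦
    (eLpNorm_one_japaneseWeight_mul_le hh).trans (mul_le_mul' hK₀K le_rfl)
  have h2W : ∀ h : E → ℂ, eLpNorm (fun x ↦ japaneseWeight (-s) x * h x) 2 volume ≤
        ENNReal.ofReal K * eLpNorm h 2 volume := fun h ↦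
    (eLpNorm_two_japaneseWeight_mul_le hs h).trans (le_mul_of_one_le_left zero_le
      (by rw [← ENNReal.ofReal_one]; exact ENNReal.ofReal_le_ofReal hK1))
  let J : 𝓢(E, ℂ) →L[ℂ] Lp ℂ 2 (volume : Measure E) := SchwartzMap.toLpCLM ℂ ℂ 2 volume
  have hJnorm : ∀ h : 𝓢(E, ℂ), eLpNorm h 2 volume = ENNReal.ofReal ‖J h‖ := fun h ↦ by
    change _ = ENNReal.ofReal ‖h.toLp 2 volume‖
    rw [SchwartzMap.norm_toLp, ENNReal.ofReal_toReal (h.memLp 2 volume).2.ne]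
  have hJcoe : ∀ h : 𝓢(E, ℂ), J h =ᵐ[volume] h := fun h ↦ h.coeFn_toLp 2 volume
  have hJdense : DenseRange J := SchwartzMap.denseRange_toLpCLM ENNReal.ofNat_ne_top
  let TW : 𝓢(E, ℂ) →ₗ[ℂ] ℂ := T ∘ₗ W.toLinearMap
  have hbound : ∀ h, ‖TW h‖ ≤ (M * K) * ‖J.toLinearMap h‖ := by
    intro h
    change ‖T (W h)‖ ≤ M * K * ‖J h‖
    have hM0 : 0 ≤ M := by simpa using hT 0 (by simp) (by simp)
    refine le_of_forall_pos_le_add fun ε hε ↦ ?_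
    -- The extra δ keeps the normalizing factor c finite when the L² norm of h vanishes.
    set δ := ε / (M * K + 1) with hδ
    have hMK : 0 ≤ M * K := by positivity
    have hδ0 : 0 < δ := by positivity
    set c : ℝ := (K * (‖J h‖ + δ))⁻¹ with hc
    have hpos : 0 < K * (‖J h‖ + δ) := by positivity
    have hc0 : 0 < c := by positivity
    have hsc : ∀ p : ℝ≥0∞, eLpNorm (W h) p volume ≤ ENNReal.ofReal K * eLpNorm h 2 volume →
        eLpNorm ((c : ℂ) • W h : 𝓢(E, ℂ)) p volume ≤ 1 := fun p hp ↦ by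
      have : ((((c : ℂ) • W h : 𝓢(E, ℂ))) : E → ℂ) = (c : ℂ) • (W h : E → ℂ) := by
        ext; rfl
      rw [this, eLpNorm_const_smul]
      refine (mul_le_mul' le_rfl hp).trans ?_
      rw [hJnorm, ← ENNReal.ofReal_mul (by positivity), ← ofReal_norm, Complex.norm_real,
        Real.norm_of_nonneg hc0.le, ← ENNReal.ofReal_mul hc0.le, ← ENNReal.ofReal_one]
      refine ENNReal.ofReal_le_ofReal ?_
      rw [hc, inv_mul_le_iff₀ hpos, mul_one]
      gcongr
      linarith
    have hWh : (W h : E → ℂ) = fun x ↦ japaneseWeight (-s) x * h x := funext (hW h)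
    have := hT ((c : ℂ) • W h) (hsc 1 (hWh ▸ h1W h h.continuous.aestronglyMeasurable))
      (hsc 2 (hWh ▸ h2W h))
    rw [map_smul, norm_smul, Complex.norm_real, Real.norm_of_nonneg hc0.le, hc,
      inv_mul_le_iff₀ hpos] at this
    have h3 : (M * K) * δ ≤ ε := by
      rw [hδ, mul_div_assoc', div_le_iff₀ (by positivity)]
      nlinarith
    calc ‖T (W h)‖ ≤ K * (‖J h‖ + δ) * M := this
      _ = M * K * ‖J h‖ + M * K * δ := by ring
      _ ≤ _ := by linarith
  let Λ : Lp ℂ 2 (volume : Measure E) →L[ℂ] ℂ := TW.extendOfNorm J.toLinearMap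
  have hΛ : ∀ h, Λ (J h) = T (W h) := fun h ↦
    LinearMap.extendOfNorm_eq (f := TW) (e := J.toLinearMap) hJdense ⟨_, hbound⟩ h
  let g₀ : Lp ℂ 2 (volume : Measure E) := (InnerProductSpace.toDual ℂ _).symm Λ
  have hΛg : ∀ F, Λ F = ∫ x, F x * (starRingEnd ℂ) (g₀ x) := fun F ↦ by
    rw [← InnerProductSpace.toDual_symm_apply (𝕜 := ℂ) (x := F) (y := Λ), L2.inner_def]
    rfl
  have hint : ∀ F : Lp ℂ 2 (volume : Measure E),
      Integrable fun x ↦ F x * (starRingEnd ℂ) (g₀ x) := fun F ↦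
    L2.integrable_inner (𝕜 := ℂ) g₀ F
  let g : E → ℂ := fun x ↦ (starRingEnd ℂ) (g₀ x) * japaneseWeight s x
  have hTW' : ∀ f, T f = Λ (J (W' f)) := fun f ↦ by rw [hΛ, hWW']
  have hcongr : ∀ (φ : E → ℂ) (F : Lp ℂ 2 (volume : Measure E)),
      F =ᵐ[volume] (fun x ↦ japaneseWeight s x * φ x) →
      (fun x ↦ F x * (starRingEnd ℂ) (g₀ x)) =ᵐ[volume] fun x ↦ φ x * g x := by
    intro φ F hF
    filter_upwards [hF] with x hx
    rw [hx]
    ring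
  have hJW' : ∀ f, J (W' f) =ᵐ[volume] (fun x ↦ japaneseWeight s x * f x) := fun f ↦
    (hJcoe _).trans (.of_forall (hW' f))
  let T' : 𝓢'(E, ℂ) := ContinuousLinearMap.toPointwiseConvergenceCLM _ _ _ _ (Λ ∘L J ∘L W')
  have hT' : ∀ f, T' f = Λ (J (W' f)) := fun f ↦ rfl
  refine ⟨g, T', ?_, fun f ↦ by rw [hT', hTW'], fun f ↦ ⟨?_, ?_⟩, ?_⟩
  · exact (Complex.continuous_conj.comp_stronglyMeasurable (Lp.stronglyMeasurable g₀)).mul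
      (continuous_japaneseWeight s).stronglyMeasurable
  · exact (hint _).congr (hcongr f _ (hJW' f))
  · rw [hT', hΛg]
    exact integral_congr_ae (hcongr f _ (hJW' f))
  · intro φ B R hφ hB hR
    have hmem : MemLp (fun x ↦ japaneseWeight s x * φ x) 2 volume := by
      have hb : ∀ x, ‖japaneseWeight s x * φ x‖ ≤
          (Metric.closedBall (0 : E) R).indicator (fun _ ↦ (1 + R ^ 2) ^ s * B) x := by
        intro x
        have hB0 : 0 ≤ B := (norm_nonneg _).trans (hB x)
        by_cases hx : x ∈ Metric.closedBall (0 : E) R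
        · rw [indicator_of_mem hx, norm_mul, japaneseWeight, Complex.norm_real,
            Real.norm_of_nonneg (by positivity)]
          have hx' : ‖x‖ ≤ R := by simpa using hx
          gcongr
          exact hB x
        · rw [indicator_of_notMem hx]
          have hx' : R < ‖x‖ := by simpa using hx
          simp [hR x hx']
      refine (memLp_indicator_const 2 (Metric.isClosed_closedBall.measurableSet)
        ((1 + R ^ 2) ^ s * B) (.inr ?_)).mono
        ((continuous_japaneseWeight s).aestronglyMeasurable.mul hφ)
        (.of_forall fun x ↦ (hb x).trans (Real.le_norm_self _))
      exact (isCompact_closedBall (0 : E) R).measure_lt_top.ne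
    set F : Lp ℂ 2 (volume : Measure E) := hmem.toLp _ with hF
    have hFcoe : F =ᵐ[volume] (fun x ↦ japaneseWeight s x * φ x) := hmem.coeFn_toLp
    refine ⟨(hint _).congr (hcongr φ _ hFcoe), fun ε hε ↦ ?_⟩
    -- This size makes both Kδ, the error in L¹ and L², and ‖Λ‖δ, the error in the pairing, at most
    -- ε.
    set δ : ℝ := ε / (K + ‖Λ‖) with hδ
    have hKΛ : 0 < K + ‖Λ‖ := by positivity
    have hδ0 : 0 < δ := by positivity
    obtain ⟨h, hh⟩ := hJdense.exists_dist_lt F hδ0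
    rw [dist_comm, dist_eq_norm] at hh
    have hdiff : eLpNorm (fun x ↦ h x - japaneseWeight s x * φ x) 2 volume ≤
        ENNReal.ofReal δ := by
      have : eLpNorm (fun x ↦ h x - japaneseWeight s x * φ x) 2 volume =
          eLpNorm (J h - F : Lp ℂ 2 (volume : Measure E)) 2 volume := by
        refine eLpNorm_congr_ae ?_
        filter_upwards [hJcoe h, hFcoe, Lp.coeFn_sub (J h) F] with x h1 h2 h3
        rw [h3, Pi.sub_apply, h1, h2]
      rw [this, ← Lp.enorm_def, ← ofReal_norm]
      exact ENNReal.ofReal_le_ofReal hh.le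
    have hKδ : ENNReal.ofReal K * ENNReal.ofReal δ ≤ ENNReal.ofReal ε := by
      rw [← ENNReal.ofReal_mul (by positivity)]
      refine ENNReal.ofReal_le_ofReal ?_
      rw [hδ, mul_div_assoc', div_le_iff₀ hKΛ]
      nlinarith [norm_nonneg Λ]
    have hWh : (fun x ↦ W h x - φ x) =
        fun x ↦ japaneseWeight (-s) x * (h x - japaneseWeight s x * φ x) := by
      ext x
      rw [hW, mul_sub, ← mul_assoc _ _ (φ x), japaneseWeight_neg_mul, one_mul]
    have hmeas : AEStronglyMeasurable (fun x ↦ h x - japaneseWeight s x * φ x) volume :=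
      h.continuous.aestronglyMeasurable.sub
        ((continuous_japaneseWeight s).aestronglyMeasurable.mul hφ)
    refine ⟨W h, ?_, ?_, ?_⟩
    · rw [hWh]
      exact (h1W _ hmeas).trans ((mul_le_mul' le_rfl hdiff).trans hKδ)
    · rw [hWh]
      exact (h2W _).trans ((mul_le_mul' le_rfl hdiff).trans hKδ)
    · rw [← hΛ, ← integral_congr_ae (hcongr φ _ hFcoe), ← hΛg, ← map_sub]
      refine (Λ.le_opNorm_of_le hh.le).trans ?_
      rw [hδ, mul_div_assoc', div_le_iff₀ hKΛ]
      nlinarith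

/-! ### Duality for Lorentz norms through test families -/

/-- Families of Schwartz functions with `‖f_j‖₁ ≤ 2^j` and `‖f_j‖₂ ≤ 2^{j/2}`, which is how
functions bounded by `1` on sets of measure `2^j` behave. -/
def IsTestFamily (f : ℤ → 𝓢(EuclideanSpace ℝ (Fin n), ℂ)) : Prop :=
  ∀ j, eLpNorm (f j) 1 volume ≤ ENNReal.ofReal (2 ^ j) ∧
    eLpNorm (f j) 2 volume ≤ ENNReal.ofReal (((2 : ℝ) ^ j) ^ (1 / 2 : ℝ))

theorem exists_subset_of_lt_distribFun {g : EuclideanSpace ℝ (Fin n) → ℂ} {s t : ℝ}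
    (h : ENNReal.ofReal t < distribFun g s) :
    ∃ R : ℝ, ENNReal.ofReal t <
      volume ({x | s < ‖g x‖} ∩ Metric.closedBall (0 : EuclideanSpace ℝ (Fin n)) R) := by
  have hU : {x | s < ‖g x‖} = ⋃ k : ℕ, {x | s < ‖g x‖} ∩
      Metric.closedBall (0 : EuclideanSpace ℝ (Fin n)) k := by
    rw [← inter_iUnion, Metric.iUnion_closedBall_nat, inter_univ]
  have hmono : Monotone fun k : ℕ ↦ {x | s < ‖g x‖} ∩
      Metric.closedBall (0 : EuclideanSpace ℝ (Fin n)) k := fun k l hkl ↦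
    inter_subset_inter_right _ (Metric.closedBall_subset_closedBall (by exact_mod_cast hkl))
  rw [distribFun, hU, hmono.measure_iUnion] at h
  obtain ⟨k, hk⟩ := lt_iSup_iff.1 h
  exact ⟨k, hk⟩

/-- A test function detecting that `{|g| > s}` has measure larger than `t`. -/
theorem exists_test_of_lt_distribFun {g : EuclideanSpace ℝ (Fin n) → ℂ}
    {T : 𝓢(EuclideanSpace ℝ (Fin n), ℂ) →ₗ[ℂ] ℂ} (hg : StronglyMeasurable g)
    (happ : ∀ (φ : EuclideanSpace ℝ (Fin n) → ℂ) (B R : ℝ), AEStronglyMeasurable φ volume →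
        (∀ x, ‖φ x‖ ≤ B) → (∀ x, R < ‖x‖ → φ x = 0) → Integrable (fun x ↦ φ x * g x) ∧
        ∀ ε : ℝ, 0 < ε → ∃ f : 𝓢(EuclideanSpace ℝ (Fin n), ℂ),
          eLpNorm (fun x ↦ f x - φ x) 1 volume ≤ ENNReal.ofReal ε ∧
          eLpNorm (fun x ↦ f x - φ x) 2 volume ≤ ENNReal.ofReal ε ∧
          ‖T f - ∫ x, φ x * g x‖ ≤ ε)
    {s t : ℝ} (hs : 0 < s) (ht : 0 < t) (h : ENNReal.ofReal t < distribFun g s) :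
    ∃ f : 𝓢(EuclideanSpace ℝ (Fin n), ℂ), eLpNorm f 1 volume ≤ ENNReal.ofReal t ∧
      eLpNorm f 2 volume ≤ ENNReal.ofReal (t ^ (1 / 2 : ℝ)) ∧ t * s ≤ 4 * ‖T f‖ := by
  obtain ⟨R, hR⟩ := exists_subset_of_lt_distribFun h
  set A : Set (EuclideanSpace ℝ (Fin n)) := {x | s < ‖g x‖} ∩ Metric.closedBall 0 R with hA
  have hAm : MeasurableSet A :=
    (measurableSet_lt measurable_const hg.measurable.norm).inter
      Metric.isClosed_closedBall.measurableSet
  have hAtop : volume A ≠ ∞ := ((measure_mono inter_subset_right).trans_lt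
    (isCompact_closedBall (0 : EuclideanSpace ℝ (Fin n)) R).measure_lt_top).ne
  set V : ℝ := (volume A).toReal with hV
  have hVA : volume A = ENNReal.ofReal V := (ENNReal.ofReal_toReal hAtop).symm
  have htV : t < V := by
    rw [hVA] at hR
    exact (ENNReal.ofReal_lt_ofReal_iff_of_nonneg ht.le).1 hR
  have hV0 : 0 < V := ht.trans htV
  -- The set A may have measure V much larger than t. The height t/V makes the L¹ norm exactly t,
  -- and the L² norm is t/V^{1/2} ≤ t^{1/2}.
  set c : ℝ := t / V with hc
  have hc0 : 0 < c := by positivity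
  let φ : EuclideanSpace ℝ (Fin n) → ℂ :=
    A.indicator fun x ↦ (c : ℂ) * ((starRingEnd ℂ) (g x) * ((‖g x‖⁻¹ : ℝ) : ℂ))
  have hφm : AEStronglyMeasurable φ volume := by
    refine AEStronglyMeasurable.indicator ?_ hAm
    refine Measurable.aestronglyMeasurable ?_
    have h1 := hg.measurable
    have h2 : Measurable fun x ↦ (starRingEnd ℂ) (g x) := Complex.continuous_conj.measurable.comp h1
    fun_prop
  have hφA : ∀ x ∈ A, ‖φ x‖ = c := fun x hx ↦ by
    have : 0 < ‖g x‖ := hs.trans hx.1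
    simp only [φ, indicator_of_mem hx]
    rw [norm_mul, norm_mul, RCLike.norm_conj, Complex.norm_real, Complex.norm_real,
      Real.norm_of_nonneg hc0.le, Real.norm_of_nonneg (by positivity), mul_inv_cancel₀ this.ne',
      mul_one]
  have hφ0 : ∀ x, x ∉ A → φ x = 0 := fun x hx ↦ indicator_of_notMem hx _
  have hφind : ∀ x, ‖φ x‖ = ‖A.indicator (fun _ ↦ c) x‖ := fun x ↦ by
    by_cases hx : x ∈ A
    · rw [hφA x hx, indicator_of_mem hx, Real.norm_of_nonneg hc0.le]
    · rw [hφ0 x hx, indicator_of_notMem hx, norm_zero, norm_zero]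
  obtain ⟨hint, hf⟩ := happ φ c R hφm
    (fun x ↦ by
      by_cases hx : x ∈ A
      · exact (hφA x hx).le
      · rw [hφ0 x hx, norm_zero]; exact hc0.le)
    (fun x hx ↦ hφ0 x fun hxA ↦ by
      have : ‖x‖ ≤ R := by simpa using hxA.2
      linarith)
  have hφ1 : eLpNorm φ 1 volume ≤ ENNReal.ofReal t := by
    rw [eLpNorm_congr_norm_ae (.of_forall hφind), eLpNorm_indicator_const hAm one_ne_zero
      ENNReal.one_ne_top, hVA, ← ofReal_norm, Real.norm_of_nonneg hc0.le]
    simp only [ENNReal.toReal_one, div_one, ENNReal.rpow_one]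
    rw [← ENNReal.ofReal_mul hc0.le, hc, div_mul_cancel₀ _ hV0.ne']
  have hφ2 : eLpNorm φ 2 volume ≤ ENNReal.ofReal (t ^ (1 / 2 : ℝ)) := by
    rw [eLpNorm_congr_norm_ae (.of_forall hφind), eLpNorm_indicator_const hAm two_ne_zero
      ENNReal.ofNat_ne_top, hVA, ← ofReal_norm, Real.norm_of_nonneg hc0.le,
      ENNReal.toReal_ofNat, ENNReal.ofReal_rpow_of_pos hV0, ← ENNReal.ofReal_mul hc0.le]
    refine ENNReal.ofReal_le_ofReal ?_
    have h1 : t = t ^ (1 / 2 : ℝ) * t ^ (1 / 2 : ℝ) := by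
      rw [← Real.rpow_add ht]; norm_num
    have h2 : V = V ^ (1 / 2 : ℝ) * V ^ (1 / 2 : ℝ) := by
      rw [← Real.rpow_add hV0]; norm_num
    have h3 : t ^ (1 / 2 : ℝ) ≤ V ^ (1 / 2 : ℝ) := Real.rpow_le_rpow ht.le htV.le (by norm_num)
    have h4 : 0 < V ^ (1 / 2 : ℝ) := by positivity
    rw [hc, div_mul_eq_mul_div, div_le_iff₀ hV0]
    have h5 : t * V ^ (1 / 2 : ℝ) =
        t ^ (1 / 2 : ℝ) * (t ^ (1 / 2 : ℝ) * V ^ (1 / 2 : ℝ)) := by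
      conv_lhs => rw [h1]
      ring
    rw [h5]
    refine mul_le_mul_of_nonneg_left ?_ (by positivity)
    conv_rhs => rw [h2]
    exact mul_le_mul_of_nonneg_right h3 h4.le
  have hφg : t * s ≤ ‖∫ x, φ x * g x‖ := by
    have h1 : ∀ x, φ x * g x = ((A.indicator (fun x ↦ c * ‖g x‖) x : ℝ) : ℂ) := fun x ↦ by
      by_cases hx : x ∈ A
      · have : 0 < ‖g x‖ := hs.trans hx.1
        simp only [φ, indicator_of_mem hx]
        have h2 : (starRingEnd ℂ) (g x) * g x = ((‖g x‖ ^ 2 : ℝ) : ℂ) := by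
          rw [mul_comm, Complex.mul_conj, Complex.normSq_eq_norm_sq]
        calc (c : ℂ) * ((starRingEnd ℂ) (g x) * ((‖g x‖⁻¹ : ℝ) : ℂ)) * g x
            = c * ((starRingEnd ℂ) (g x) * g x) * ((‖g x‖⁻¹ : ℝ) : ℂ) := by ring
          _ = _ := by
            rw [h2, ← Complex.ofReal_mul, ← Complex.ofReal_mul]
            congr 1
            field_simp
      · simp [hφ0 x hx, indicator_of_notMem hx]
    have hint' : Integrable (A.indicator (fun x ↦ c * ‖g x‖)) := by
      refine hint.norm.congr (.of_forall fun x ↦ ?_)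
      simp only [h1, Complex.norm_real]
      exact Real.norm_of_nonneg (indicator_nonneg (fun x _ ↦ by positivity) x)
    simp_rw [h1]
    rw [integral_complex_ofReal, Complex.norm_real]
    refine le_trans ?_ (Real.le_norm_self _)
    rw [integral_indicator hAm]
    refine le_trans (le_of_eq ?_) (setIntegral_ge_of_const_le (c := c * s) hAm hAtop (fun x hx ↦ ?_)
      ((integrable_indicator_iff hAm).1 hint'))
    · rw [measureReal_def, ← hV, hc, smul_eq_mul]
      field_simp
    · exact mul_le_mul_of_nonneg_left hx.1.le hc0.le
  have hts : 0 < t * s / 2 := by positivity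
  have ht2 : 0 < t ^ (1 / 2 : ℝ) := by positivity
  -- The approximation at most doubles both norm bounds, so f/2 is used. The pairing retains at
  -- least ts/2 for f, hence ts/4 for f/2: this is the factor 4.
  set ε : ℝ := min (min t (t ^ (1 / 2 : ℝ))) (t * s / 2) with hε
  obtain ⟨f, hf1, hf2, hf3⟩ := hf ε (by positivity)
  have hhalf : ∀ (p : ℝ≥0∞) (y : ℝ), 1 ≤ p → 0 < y → ε ≤ y →
      eLpNorm φ p volume ≤ ENNReal.ofReal y →
      eLpNorm (fun x ↦ f x - φ x) p volume ≤ ENNReal.ofReal ε →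
      eLpNorm (((1 / 2 : ℝ) : ℂ) • f : 𝓢(EuclideanSpace ℝ (Fin n), ℂ)) p volume ≤
        ENNReal.ofReal y := by
    intro p y hp hy hεy h1 h2
    have e1 : (((((1 / 2 : ℝ) : ℂ) • f : 𝓢(EuclideanSpace ℝ (Fin n), ℂ))) :
        EuclideanSpace ℝ (Fin n) → ℂ) = ((1 / 2 : ℝ) : ℂ) • ((fun x ↦ f x - φ x) + φ) := by
      ext x
      simp
    rw [e1, eLpNorm_const_smul]
    have h3 := (eLpNorm_add_le (f.continuous.aestronglyMeasurable.sub hφm) hφm hp).trans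
      (add_le_add (h2.trans (ENNReal.ofReal_le_ofReal hεy)) h1)
    refine (mul_le_mul' le_rfl h3).trans ?_
    rw [← ENNReal.ofReal_add hy.le hy.le, ← ofReal_norm, ← ENNReal.ofReal_mul (norm_nonneg _)]
    refine ENNReal.ofReal_le_ofReal ?_
    rw [Complex.norm_real, Real.norm_of_nonneg (by norm_num)]
    linarith
  refine ⟨((1 / 2 : ℝ) : ℂ) • f,
    hhalf 1 t le_rfl ht ((min_le_left _ _).trans (min_le_left _ _)) hφ1 hf1,
    hhalf 2 _ one_le_two ht2 ((min_le_left _ _).trans (min_le_right _ _)) hφ2 hf2, ?_⟩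
  rw [map_smul, norm_smul, Complex.norm_real, Real.norm_of_nonneg (by norm_num)]
  have h4 : ‖∫ x, φ x * g x‖ ≤ ‖T f‖ + ε := by
    have := norm_sub_norm_le (∫ x, φ x * g x) (T f)
    rw [norm_sub_rev] at this
    linarith
  have h5 : ε ≤ t * s / 2 := min_le_right _ _
  linarith

/-- Duality: a functional that is controlled on all test families is given by a function in the
Lorentz space. -/
theorem exists_represents_lorentzNorm_le {p : ℝ} (hp : 0 < p) {q : ℝ≥0∞} (hq0 : q ≠ 0) :
    ∃ C : ℝ≥0∞, C ≠ ∞ ∧ ∀ (T : 𝓢(EuclideanSpace ℝ (Fin n), ℂ) →ₗ[ℂ] ℂ) (M : ℝ≥0∞), M ≠ ∞ →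
      (∀ f : ℤ → 𝓢(EuclideanSpace ℝ (Fin n), ℂ), IsTestFamily f →
        seqNorm q (fun j ↦ ENNReal.ofReal (((2 : ℝ) ^ j) ^ (1 / p - 1)) * ‖T (f j)‖ₑ) ≤ M) →
      ∃ (g : EuclideanSpace ℝ (Fin n) → ℂ) (T' : 𝓢'(EuclideanSpace ℝ (Fin n), ℂ)),
        StronglyMeasurable g ∧ (∀ f, T' f = T f) ∧ Represents g T' ∧
        lorentzNorm p q g ≤ C * M := by
  obtain ⟨C, hC, hCle⟩ := lorentzNorm_le_seqNorm (n := n) hp hq0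
  -- The 8 is 4 from the test function times 2 from testing at half the value of the rearrangement.
  refine ⟨C * 8, ENNReal.mul_ne_top hC ENNReal.ofNat_ne_top, fun T M hM hT ↦ ?_⟩
  have hzero : ∀ j : ℤ, eLpNorm (0 : 𝓢(EuclideanSpace ℝ (Fin n), ℂ)) 1 volume ≤
      ENNReal.ofReal (2 ^ j) ∧ eLpNorm (0 : 𝓢(EuclideanSpace ℝ (Fin n), ℂ)) 2 volume ≤
        ENNReal.ofReal (((2 : ℝ) ^ j) ^ (1 / 2 : ℝ)) := fun j ↦ by simp
  -- A family with one nonzero member bounds a single function; level j = 0 supplies the L¹ ∩ L²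
  -- bound from which g is obtained.
  have hsingle : ∀ (j : ℤ) (f : 𝓢(EuclideanSpace ℝ (Fin n), ℂ)),
      eLpNorm f 1 volume ≤ ENNReal.ofReal (2 ^ j) →
      eLpNorm f 2 volume ≤ ENNReal.ofReal (((2 : ℝ) ^ j) ^ (1 / 2 : ℝ)) →
      ENNReal.ofReal (((2 : ℝ) ^ j) ^ (1 / p - 1)) * ‖T f‖ₑ ≤ M := by
    intro j f h1 h2
    have := (le_seqNorm hq0 _ j).trans (hT (Function.update 0 j f) fun i ↦ by
      by_cases hi : i = j
      · subst hi; rw [Function.update_self]; exact ⟨h1, h2⟩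
      · rw [Function.update_of_ne hi]; exact hzero i)
    simpa using this
  obtain ⟨g, T', hg, hT', hrep, happ⟩ := exists_represents_of_bounded T M.toReal fun f h1 h2 ↦ by
    have := hsingle 0 f (by simpa using h1) (by simpa using h2)
    simp only [zpow_zero, Real.one_rpow, ENNReal.ofReal_one, one_mul] at this
    rw [← toReal_enorm]
    exact ENNReal.toReal_mono hM this
  refine ⟨g, T', hg, hT', hrep, ?_⟩
  have htest : ∀ (j : ℤ) (s : ℝ), 0 < s →
      ENNReal.ofReal s < rearrangement g ((2 : ℝ) ^ j) →
      ∃ f : 𝓢(EuclideanSpace ℝ (Fin n), ℂ), (eLpNorm f 1 volume ≤ ENNReal.ofReal (2 ^ j) ∧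
        eLpNorm f 2 volume ≤ ENNReal.ofReal (((2 : ℝ) ^ j) ^ (1 / 2 : ℝ))) ∧
        ENNReal.ofReal (((2 : ℝ) ^ j) ^ (1 / p)) * ENNReal.ofReal s ≤
          4 * (ENNReal.ofReal (((2 : ℝ) ^ j) ^ (1 / p - 1)) * ‖T f‖ₑ) := by
    intro j s hs h
    have h0 : (0 : ℝ) < 2 ^ j := by positivity
    obtain ⟨f, h1, h2, h3⟩ := exists_test_of_lt_distribFun hg happ hs h0
      (lt_distribFun_of_lt_rearrangement hs h)
    refine ⟨f, ⟨h1, h2⟩, ?_⟩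
    rw [← ofReal_norm, ← ENNReal.ofReal_mul (by positivity), ← ENNReal.ofReal_mul (by positivity),
      ← ENNReal.ofReal_ofNat 4, ← ENNReal.ofReal_mul (by positivity)]
    refine ENNReal.ofReal_le_ofReal ?_
    have h4 : ((2 : ℝ) ^ j) ^ (1 / p) = ((2 : ℝ) ^ j) ^ (1 / p - 1) * 2 ^ j := by
      rw [Real.rpow_sub_one h0.ne', div_mul_cancel₀ _ h0.ne']
    rw [h4]
    calc ((2 : ℝ) ^ j) ^ (1 / p - 1) * 2 ^ j * s = ((2 : ℝ) ^ j) ^ (1 / p - 1) * (2 ^ j * s) := by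
          ring
      _ ≤ ((2 : ℝ) ^ j) ^ (1 / p - 1) * (4 * ‖T f‖) := by gcongr
      _ = _ := by ring
  -- An infinite value would allow every s in `htest`, against the bound `hsingle`; s is chosen so
  -- that the left side becomes (4M) + 1.
  have hfin : ∀ j : ℤ, rearrangement g ((2 : ℝ) ^ j) ≠ ∞ := by
    intro j hj
    have h0 : (0 : ℝ) < 2 ^ j := by positivity
    have hw : (0 : ℝ) < ((2 : ℝ) ^ j) ^ (1 / p) := by positivity
    set s : ℝ := ((4 * M).toReal + 1) / ((2 : ℝ) ^ j) ^ (1 / p) with hs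
    have hs0 : 0 < s := by positivity
    obtain ⟨f, hf, hle⟩ := htest j s hs0 (by rw [hj]; exact ENNReal.ofReal_lt_top)
    have h1 := hle.trans (mul_le_mul' le_rfl (hsingle j f hf.1 hf.2))
    rw [← ENNReal.ofReal_mul hw.le, hs, mul_div_cancel₀ _ hw.ne',
      ENNReal.ofReal_le_iff_le_toReal (ENNReal.mul_ne_top ENNReal.ofNat_ne_top hM)] at h1
    linarith
  have hchoose : ∀ j : ℤ, ∃ f : 𝓢(EuclideanSpace ℝ (Fin n), ℂ),
      (eLpNorm f 1 volume ≤ ENNReal.ofReal (2 ^ j) ∧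
        eLpNorm f 2 volume ≤ ENNReal.ofReal (((2 : ℝ) ^ j) ^ (1 / 2 : ℝ))) ∧
      dyadicSeq p g j ≤ 8 * (ENNReal.ofReal (((2 : ℝ) ^ j) ^ (1 / p - 1)) * ‖T f‖ₑ) := by
    intro j
    by_cases hz : rearrangement g ((2 : ℝ) ^ j) = 0
    · exact ⟨0, hzero j, by simp [dyadicSeq, hz]⟩
    have hpos : 0 < (rearrangement g ((2 : ℝ) ^ j)).toReal := ENNReal.toReal_pos hz (hfin j)
    obtain ⟨f, hf, hle⟩ := htest j ((rearrangement g ((2 : ℝ) ^ j)).toReal / 2) (by positivity) (by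
      rw [ENNReal.ofReal_lt_iff_lt_toReal (by positivity) (hfin j)]
      linarith)
    refine ⟨f, hf, ?_⟩
    have : rearrangement g ((2 : ℝ) ^ j) =
        2 * ENNReal.ofReal ((rearrangement g ((2 : ℝ) ^ j)).toReal / 2) := by
      rw [← ENNReal.ofReal_ofNat 2, ← ENNReal.ofReal_mul (by positivity),
        mul_div_cancel₀ _ two_ne_zero, ENNReal.ofReal_toReal (hfin j)]
    rw [dyadicSeq, this, mul_left_comm]
    refine (mul_le_mul' le_rfl hle).trans (le_of_eq ?_)
    rw [← mul_assoc]
    norm_num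
  choose f hf hle using hchoose
  refine (hCle g).trans ?_
  rw [mul_assoc]
  refine mul_le_mul' le_rfl ((seqNorm_mono hle).trans ?_)
  rw [seqNorm_const_mul hq0]
  exact mul_le_mul' le_rfl (hT f hf)

/-! ### Pairing the nonlinearity with bounded, square integrable functions -/

theorem exists_ball_volume_le (hn : 0 < n) : ∃ ρ : ℝ, 0 < ρ ∧ ∀ k : ℤ,
    volume (Metric.closedBall (0 : EuclideanSpace ℝ (Fin n)) (ρ * ((2 : ℝ) ^ k) ^ (1 / (n : ℝ)))) ≤
      ENNReal.ofReal (2 ^ k) := by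
  have hn' : (n : ℝ) ≠ 0 := by positivity
  set v : ℝ := (volume (Metric.ball (0 : EuclideanSpace ℝ (Fin n)) 1)).toReal with hv
  have hv0 : 0 ≤ v := ENNReal.toReal_nonneg
  have hvb : volume (Metric.ball (0 : EuclideanSpace ℝ (Fin n)) 1) = ENNReal.ofReal v :=
    (ENNReal.ofReal_toReal Metric.isBounded_ball.measure_lt_top.ne).symm
  refine ⟨(v + 1)⁻¹, by positivity, fun k ↦ ?_⟩
  rw [Measure.addHaar_closedBall _ _ (by positivity), hvb, ← ENNReal.ofReal_mul (by positivity)]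
  refine ENNReal.ofReal_le_ofReal ?_
  have h0 : (0 : ℝ) < 2 ^ k := by positivity
  rw [finrank_euclideanSpace_fin, mul_pow, ← Real.rpow_natCast (((2 : ℝ) ^ k) ^ (1 / (n : ℝ))),
    ← Real.rpow_mul h0.le, one_div_mul_cancel hn', Real.rpow_one]
  have h1 : ((v + 1)⁻¹) ^ n ≤ (v + 1)⁻¹ :=
    pow_le_of_le_one (by positivity) (inv_le_one_of_one_le₀ (by linarith)) hn.ne'
  have h2 : (v + 1)⁻¹ * v ≤ 1 := by
    rw [inv_mul_le_iff₀ (by positivity)]; linarith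
  calc ((v + 1)⁻¹) ^ n * 2 ^ k * v ≤ (v + 1)⁻¹ * 2 ^ k * v := by gcongr
    _ = (v + 1)⁻¹ * v * 2 ^ k := by ring
    _ ≤ 1 * 2 ^ k := by gcongr
    _ = 2 ^ k := one_mul _

theorem enorm_nonlinearity_le {b α : ℝ} (hb : 0 < b) (hα : 0 < α)
    {w : EuclideanSpace ℝ (Fin n) → ℂ} {x : EuclideanSpace ℝ (Fin n)} {R : ℝ} (hR : 0 < R)
    (hx : R < ‖x‖) {L : ℝ≥0∞} (hL : ‖w x‖ₑ ≤ L) :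
    ‖nonlinearity b α w x‖ₑ ≤ ENNReal.ofReal (R ^ (-b)) * L ^ (α + 1) := by
  rw [nonlinearity, enorm_mul, ENNReal.rpow_add_of_nonneg _ _ hα.le zero_le_one, ENNReal.rpow_one,
    ← mul_assoc]
  refine mul_le_mul' ?_ hL
  rw [← ofReal_norm, Complex.norm_real, Real.norm_of_nonneg (by positivity),
    ENNReal.ofReal_mul (by positivity), ← ENNReal.ofReal_rpow_of_nonneg (norm_nonneg _) hα.le,
    ofReal_norm]
  refine mul_le_mul' (ENNReal.ofReal_le_ofReal ?_) (ENNReal.rpow_le_rpow hL hα.le)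
  exact Real.rpow_le_rpow_of_nonpos hR hx.le (by linarith)

/-- The two bounds come from the supremum of φ and from Cauchy–Schwarz. Keeping their minimum is
what later makes the kernel decay in both directions. -/
theorem lintegral_enorm_le_of_bounds {φ : EuclideanSpace ℝ (Fin n) → ℂ}
    (hφm : AEStronglyMeasurable φ volume)
    {P Q : ℝ≥0∞} (hP : ∀ x, ‖φ x‖ₑ ≤ P) (hQ : eLpNorm φ 2 volume ≤ Q)
    (D : Set (EuclideanSpace ℝ (Fin n))) {V : ℝ≥0∞} (hD : volume D ≤ V) :
    ∫⁻ x in D, ‖φ x‖ₑ ≤ min (P * V) (Q * V ^ (1 / 2 : ℝ)) := by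
  refine le_min ?_ ?_
  · calc ∫⁻ x in D, ‖φ x‖ₑ ≤ ∫⁻ _ in D, P := lintegral_mono fun x ↦ hP x
      _ = P * volume D := by rw [setLIntegral_const]
      _ ≤ P * V := by gcongr
  · rw [← eLpNorm_one_eq_lintegral_enorm]
    refine (eLpNorm_le_eLpNorm_mul_rpow_measure_univ one_le_two hφm.restrict).trans ?_
    refine mul_le_mul' ((eLpNorm_restrict_le _ _ _ _).trans hQ) ?_
    rw [Measure.restrict_apply_univ]
    norm_num
    exact ENNReal.rpow_le_rpow hD (by norm_num)

/-- The pairing of `|x|^{-b} |w|^α w` with a function that is bounded and square integrable. -/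
theorem exists_lintegral_mul_nonlinearity_le (hn : 0 < n) {b α p : ℝ} (hb : 0 < b) (hα : 0 < α)
    (hexp : b / n + (α + 1) / p = 1 - 1 / p) :
    ∃ C : ℝ≥0∞, C ≠ ∞ ∧ ∀ (w φ : EuclideanSpace ℝ (Fin n) → ℂ) (P Q : ℝ≥0∞),
      AEStronglyMeasurable φ volume → (∀ x, ‖φ x‖ₑ ≤ P) → eLpNorm φ 2 volume ≤ Q →
      ∫⁻ x, ‖φ x * nonlinearity b α w x‖ₑ ≤
        C * ∑' k : ℤ, ENNReal.ofReal (((2 : ℝ) ^ k) ^ (1 / p - 1)) * dyadicSeq p w k ^ (α + 1) *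
          min (P * ENNReal.ofReal (2 ^ k)) (Q * ENNReal.ofReal (((2 : ℝ) ^ k) ^ (1 / 2 : ℝ))) := by
  obtain ⟨ρ, hρ, hball⟩ := exists_ball_volume_le hn
  have hn' : (n : ℝ) ≠ 0 := by positivity
  refine ⟨ENNReal.ofReal (ρ ^ (-b)) * 4, ENNReal.mul_ne_top ENNReal.ofReal_ne_top
    ENNReal.ofNat_ne_top, fun w φ P Q hφm hP hQ ↦ ?_⟩
  set R : ℤ → ℝ := fun k ↦ ρ * ((2 : ℝ) ^ k) ^ (1 / (n : ℝ)) with hRdef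
  have hR : ∀ k, 0 < R k := fun k ↦ by positivity
  -- Both places where the nonlinearity can be large, large |w| and small |x|, are collected in a
  -- set of measure at most 2^{k+1}; outside it the nonlinearity is at most H k.
  set D : ℤ → Set (EuclideanSpace ℝ (Fin n)) := fun k ↦
    {x | rearrangement w ((2 : ℝ) ^ k) < ‖w x‖ₑ} ∪ Metric.closedBall 0 (R k) with hDdef
  have hD : ∀ k, volume (D k) ≤ ENNReal.ofReal (2 ^ (k + 1)) := fun k ↦ by
    refine (measure_union_le _ _).trans
      ((add_le_add (volume_rearrangement_lt_le w _) (hball k)).trans ?_)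
    rw [← ENNReal.ofReal_add (by positivity) (by positivity), zpow_add_one₀ two_ne_zero, mul_two]
  set H : ℤ → ℝ≥0∞ := fun k ↦
    ENNReal.ofReal (R k ^ (-b)) * rearrangement w ((2 : ℝ) ^ k) ^ (α + 1) with hHdef
  -- The exponent identity `hexp` is used here: -b/n = (1/p - 1) + (α+1)/p.
  have hH : ∀ k, H k = ENNReal.ofReal (ρ ^ (-b)) *
      (ENNReal.ofReal (((2 : ℝ) ^ k) ^ (1 / p - 1)) * dyadicSeq p w k ^ (α + 1)) := fun k ↦ by
    have h0 : (0 : ℝ) < 2 ^ k := by positivity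
    simp only [hHdef, hRdef, dyadicSeq]
    rw [ENNReal.mul_rpow_of_nonneg _ _ (by linarith : 0 ≤ α + 1),
      ENNReal.ofReal_rpow_of_pos (by positivity), ← mul_assoc, ← mul_assoc,
      ← ENNReal.ofReal_mul (by positivity), ← ENNReal.ofReal_mul (by positivity),
      Real.mul_rpow hρ.le (by positivity), ← Real.rpow_mul h0.le, ← Real.rpow_mul h0.le,
      mul_assoc, ← Real.rpow_add h0]
    congr 4
    have : (1 / p * (α + 1)) = (α + 1) / p := by ring
    rw [this]
    have h2 : 1 / (n : ℝ) * -b = -(b / n) := by ring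
    rw [h2]
    linarith
  have hoff : ∀ k x, x ∉ D k → ‖nonlinearity b α w x‖ₑ ≤ H k := fun k x hx ↦ by
    simp only [hDdef, mem_union, mem_ofPred_eq, Metric.mem_closedBall, dist_zero_right, not_or,
      not_lt, not_le] at hx
    exact enorm_nonlinearity_le hb hα (hR k) hx.2 hx.1
  -- The measures of D k tend to 0 as k → -∞.
  have hnull : ∀ᵐ x ∂(volume : Measure (EuclideanSpace ℝ (Fin n))), ∃ k, x ∉ D k := by
    have : volume (⋂ k, D k) = 0 := by
      refine le_antisymm (le_of_forall_pos_le_add fun ε hε ↦ ?_) zero_le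
      rw [zero_add]
      obtain ⟨δ, hδ0, hδ⟩ : ∃ δ : ℝ, 0 < δ ∧ ENNReal.ofReal δ ≤ ε := by
        by_cases hε' : ε = ∞
        · exact ⟨1, one_pos, hε' ▸ le_top⟩
        · exact ⟨ε.toReal, ENNReal.toReal_pos hε.ne' hε', (ENNReal.ofReal_toReal hε').le⟩
      obtain ⟨m, hm⟩ := exists_pow_lt_of_lt_one hδ0 (by norm_num : (1 / 2 : ℝ) < 1)
      refine (measure_mono (iInter_subset D (-(m : ℤ) - 1))).trans ((hD _).trans
        ((ENNReal.ofReal_le_ofReal ?_).trans hδ))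
      rw [sub_add_cancel, zpow_neg, zpow_natCast]
      simpa using hm.le
    filter_upwards [measure_eq_zero_iff_ae_notMem.1 this] with x hx
    simpa using hx
  -- The balls in D k exhaust the space as k → ∞, so a point outside some D k must enter at a first
  -- later index.
  have hcross : ∀ x k, x ∉ D k → ∃ i, x ∉ D i ∧ x ∈ D (i + 1) := by
    intro x k hk
    by_contra! hc
    have hall : ∀ m : ℕ, x ∉ D (k + m) := fun m ↦ by
      induction m with
      | zero => simpa using hk
      | succ m ih =>
        have := hc _ ih
        rwa [Nat.cast_succ, ← add_assoc]
    have hn0 : (0 : ℝ) < (2 : ℝ) ^ k := by positivity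
    obtain ⟨m, hm⟩ := pow_unbounded_of_one_lt ((‖x‖ / ρ) ^ (n : ℝ) / 2 ^ k)
      (one_lt_two : (1 : ℝ) < 2)
    refine hall m (.inr ?_)
    rw [Metric.mem_closedBall, dist_zero_right, hRdef, ← div_le_iff₀' hρ]
    rw [div_lt_iff₀ hn0] at hm
    have h1 : (‖x‖ / ρ) = ((‖x‖ / ρ) ^ (n : ℝ)) ^ (1 / (n : ℝ)) := by
      rw [← Real.rpow_mul (by positivity), mul_one_div_cancel hn', Real.rpow_one]
    rw [h1]
    refine Real.rpow_le_rpow (by positivity) ?_ (by positivity)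
    rw [zpow_add₀ two_ne_zero, zpow_natCast, mul_comm]
    exact hm.le
  -- The function w is arbitrary here, so D k is replaced by a measurable hull of the same measure.
  let D' : ℤ → Set (EuclideanSpace ℝ (Fin n)) := fun k ↦ toMeasurable volume (D k)
  have hD'm : ∀ k, MeasurableSet (D' k) := fun k ↦ measurableSet_toMeasurable _ _
  calc ∫⁻ x, ‖φ x * nonlinearity b α w x‖ₑ
      ≤ ∫⁻ x, ∑' k, H k * (D' (k + 1)).indicator (fun x ↦ ‖φ x‖ₑ) x := by
        refine lintegral_mono_ae ?_
        filter_upwards [hnull] with x ⟨k, hk⟩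
        obtain ⟨i, hi, hi'⟩ := hcross x k hk
        refine le_trans ?_ (ENNReal.le_tsum i)
        rw [indicator_of_mem (subset_toMeasurable volume (D (i + 1)) hi'), enorm_mul, mul_comm]
        gcongr
        exact hoff i x hi
    _ = ∑' k, H k * ∫⁻ x in D' (k + 1), ‖φ x‖ₑ := by
        rw [lintegral_tsum fun k ↦ (hφm.enorm.indicator (hD'm _)).const_mul _]
        refine tsum_congr fun k ↦ ?_
        rw [lintegral_const_mul'' _ (hφm.enorm.indicator (hD'm _)), lintegral_indicator (hD'm _)]
    _ ≤ ∑' k, H k * (4 * min (P * ENNReal.ofReal (2 ^ k))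
          (Q * ENNReal.ofReal (((2 : ℝ) ^ k) ^ (1 / 2 : ℝ)))) := by
        gcongr with k
        have h0 : (0 : ℝ) < 2 ^ k := by positivity
        have hV : volume (D' (k + 1)) ≤ ENNReal.ofReal (4 * 2 ^ k) := by
          rw [measure_toMeasurable]
          refine (hD _).trans (ENNReal.ofReal_le_ofReal (le_of_eq ?_))
          rw [zpow_add_one₀ two_ne_zero, zpow_add_one₀ two_ne_zero]
          ring
        refine (lintegral_enorm_le_of_bounds hφm hP hQ _ hV).trans ?_
        rw [mul_min]
        refine min_le_min (le_of_eq ?_) ?_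
        · rw [ENNReal.ofReal_mul (by norm_num), ENNReal.ofReal_ofNat]
          ring
        · rw [ENNReal.ofReal_rpow_of_pos (by positivity), Real.mul_rpow (by norm_num) h0.le,
            ENNReal.ofReal_mul (by positivity), mul_left_comm]
          gcongr
          rw [← ENNReal.ofReal_ofNat 4]
          refine ENNReal.ofReal_le_ofReal ?_
          exact Real.rpow_le_self_of_one_le (by norm_num) (by norm_num)
    _ = _ := by
        rw [← ENNReal.tsum_mul_left]
        refine tsum_congr fun k ↦ ?_
        rw [hH]
        ring

/-! ### The dispersive estimate for the nonlinearity in dyadic form -/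

theorem tsum_min_rpow_ne_top {c d : ℝ} (hc : 0 < c) (hd : d < 0) :
    ∑' i : ℤ, ENNReal.ofReal (min (((2 : ℝ) ^ i) ^ c) (((2 : ℝ) ^ i) ^ d)) ≠ ∞ := by
  refine Summable.tsum_ofReal_ne_top ?_
  refine Summable.of_nat_of_neg ?_ ?_
  · refine Summable.of_nonneg_of_le (fun m ↦ by positivity) (fun m ↦ min_le_right _ _) ?_
    have : ∀ m : ℕ, ((2 : ℝ) ^ (m : ℤ)) ^ d = ((2 : ℝ) ^ d) ^ m := fun m ↦ by
      rw [zpow_natCast, ← Real.rpow_natCast, ← Real.rpow_natCast, ← Real.rpow_mul (by norm_num),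
        ← Real.rpow_mul (by norm_num), mul_comm]
    simp_rw [this]
    exact summable_geometric_of_lt_one (by positivity)
      (Real.rpow_lt_one_of_one_lt_of_neg one_lt_two hd)
  · refine Summable.of_nonneg_of_le (fun m ↦ by positivity) (fun m ↦ min_le_left _ _) ?_
    have : ∀ m : ℕ, ((2 : ℝ) ^ (-(m : ℤ))) ^ c = ((2 : ℝ) ^ (-c)) ^ m := fun m ↦ by
      rw [zpow_neg, zpow_natCast, ← Real.rpow_natCast, ← Real.rpow_natCast,
        ← Real.rpow_neg (by norm_num), ← Real.rpow_mul (by norm_num),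
        ← Real.rpow_mul (by norm_num)]
      congr 1
      ring
    simp_rw [this]
    exact summable_geometric_of_lt_one (by positivity)
      (Real.rpow_lt_one_of_one_lt_of_neg one_lt_two (by linarith))

/-- Young's inequality ℓ¹ * ℓ^q ⊂ ℓ^q. The kernel depends on j+k because the estimate is dual, so
each term is a reflection of A rather than a translate; reflections also preserve the norm. -/
theorem seqNorm_convolution_le {q : ℝ≥0∞} (hq1 : 1 < q) (W A : ℤ → ℝ≥0∞) (l : ℤ) :
    seqNorm q (fun j ↦ ∑' k, W (j + k - l) * A k) ≤ (∑' i, W i) * seqNorm q A := by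
  have hq0 : q ≠ 0 := (zero_lt_one.trans hq1).ne'
  have h1 : ∀ j, ∑' k, W (j + k - l) * A k = ∑' i, W i * A (l + i - j) := fun j ↦ by
    rw [← (Equiv.addRight (l - j)).tsum_eq]
    refine tsum_congr fun i ↦ ?_
    simp only [Equiv.coe_addRight]
    congr 2 <;> ring
  simp_rw [h1]
  refine (seqNorm_tsum_le hq1 (fun i j ↦ W i * A (l + i - j))).trans ?_
  rw [← ENNReal.tsum_mul_right]
  refine ENNReal.tsum_le_tsum fun i ↦ ?_
  rw [seqNorm_const_mul hq0]
  exact mul_le_mul' le_rfl (seqNorm_comp_equiv q A (Equiv.subLeft (l + i))).le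

/-- The dispersive estimate in Lorentz spaces for the nonlinearity, in its dual form. -/
theorem exists_seqNorm_pairing_le (hn : 0 < n) {b α p : ℝ} (hb : 0 < b) (hα : 0 < α) (hp : 2 < p)
    (hexp : b / n + (α + 1) / p = 1 - 1 / p) {q : ℝ≥0∞} (hq1 : 1 < q) :
    ∃ C : ℝ≥0∞, C ≠ ∞ ∧ ∀ (w : EuclideanSpace ℝ (Fin n) → ℂ) (s : ℝ), s ≠ 0 →
      ∀ f : ℤ → 𝓢(EuclideanSpace ℝ (Fin n), ℂ), IsTestFamily f →
      seqNorm q (fun j ↦ ENNReal.ofReal (((2 : ℝ) ^ j) ^ (1 / p - 1)) *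
        ∫⁻ x, ‖schrodingerTest s (f j) x * nonlinearity b α w x‖ₑ) ≤
      C * ENNReal.ofReal (|s| ^ (-(n * (1 / 2 - 1 / p)))) * lorentzNorm p q w ^ (α + 1) := by
  have hq0 : q ≠ 0 := (zero_lt_one.trans hq1).ne'
  have hp0 : 0 < p := by linarith
  have hp1 : 0 < 1 / p := by positivity
  have hp2 : 1 / p < 1 / 2 := one_div_lt_one_div_of_lt two_pos hp
  obtain ⟨C₁, hC₁, h₁⟩ := exists_lintegral_mul_nonlinearity_le hn hb hα hexp
  obtain ⟨C₂, hC₂, h₂⟩ := seqNorm_le_lorentzNorm (n := n) hp0 hq0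
  -- The first entry is the dispersive bound, decaying as i → -∞; the second is the L² bound,
  -- decaying as i → ∞ because 1/p < 1/2.
  set W : ℤ → ℝ≥0∞ := fun i ↦
    ENNReal.ofReal (min (((2 : ℝ) ^ i) ^ (1 / p)) (((2 : ℝ) ^ i) ^ (1 / p - 1 / 2))) with hW
  have hWtop : ∑' i, W i ≠ ∞ := tsum_min_rpow_ne_top hp1 (by linarith)
  refine ⟨C₁ * ENNReal.ofReal (2 ^ (1 / 2 - 1 / p)) * (∑' i, W i) * C₂ ^ (α + 1),
    ENNReal.mul_ne_top (ENNReal.mul_ne_top (ENNReal.mul_ne_top hC₁ ENNReal.ofReal_ne_top) hWtop)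
      (ENNReal.rpow_ne_top_of_nonneg (by linarith) hC₂), fun w s hs f hf ↦ ?_⟩
  have hs0 : 0 < |s| := abs_pos.2 hs
  -- The bounds |s|^{-n/2}2^{j+k} and 2^{(j+k)/2} balance at 2^{j+k} = |s|^n, so the kernel is
  -- centred at the dyadic exponent l of |s|^n.
  set X : ℝ := |s| ^ (n : ℝ) with hX
  have hX0 : 0 < X := by positivity
  obtain ⟨l, hl⟩ := exists_mem_Ico_zpow hX0 (one_lt_two : (1 : ℝ) < 2)
  have hl0 : (0 : ℝ) < 2 ^ l := by positivity
  have hdecay : |s| ^ (-((n : ℝ) / 2)) ≤ ((2 : ℝ) ^ l) ^ (-(1 / 2) : ℝ) := by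
    have : |s| ^ (-((n : ℝ) / 2)) = X ^ (-(1 / 2) : ℝ) := by
      rw [hX, ← Real.rpow_mul hs0.le]
      congr 1
      ring
    rw [this]
    exact Real.rpow_le_rpow_of_nonpos hl0 hl.1 (by norm_num)
  have hscale : ((2 : ℝ) ^ l) ^ (1 / p - 1 / 2) ≤
      2 ^ (1 / 2 - 1 / p) * |s| ^ (-(n * (1 / 2 - 1 / p))) := by
    have e1 : |s| ^ (-(n * (1 / 2 - 1 / p))) = X ^ (1 / p - 1 / 2) := by
      rw [hX, ← Real.rpow_mul hs0.le]
      congr 1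
      ring
    have e2 : (2 : ℝ) ^ (1 / 2 - 1 / p) = (2⁻¹ : ℝ) ^ (1 / p - 1 / 2) := by
      rw [Real.inv_rpow (by norm_num), ← Real.rpow_neg (by norm_num)]
      congr 1
      ring
    rw [e1, e2, ← Real.mul_rpow (by norm_num) hX0.le]
    refine Real.rpow_le_rpow_of_nonpos (by positivity) ?_ (by linarith)
    have := hl.2
    rw [zpow_add_one₀ two_ne_zero] at this
    linarith
  have hkernel : ∀ j k : ℤ, ENNReal.ofReal (((2 : ℝ) ^ j) ^ (1 / p - 1)) *
      (ENNReal.ofReal (((2 : ℝ) ^ k) ^ (1 / p - 1)) *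
        min (ENNReal.ofReal (|s| ^ (-((n : ℝ) / 2))) * ENNReal.ofReal (2 ^ j) *
            ENNReal.ofReal (2 ^ k))
          (ENNReal.ofReal (((2 : ℝ) ^ j) ^ (1 / 2 : ℝ)) *
            ENNReal.ofReal (((2 : ℝ) ^ k) ^ (1 / 2 : ℝ)))) ≤
      ENNReal.ofReal (((2 : ℝ) ^ l) ^ (1 / p - 1 / 2)) * W (j + k - l) := by
    intro j k
    have hj : (0 : ℝ) < 2 ^ j := by positivity
    have hk : (0 : ℝ) < 2 ^ k := by positivity
    set i := j + k - l with hi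
    have hi0 : (0 : ℝ) < 2 ^ i := by positivity
    have hjk : (2 : ℝ) ^ j * 2 ^ k = 2 ^ l * 2 ^ i := by
      rw [← zpow_add₀ two_ne_zero, ← zpow_add₀ two_ne_zero, hi]
      congr 1
      ring
    have hmono : Monotone ENNReal.ofReal := fun _ _ h ↦ ENNReal.ofReal_le_ofReal h
    rw [← ENNReal.ofReal_mul (by positivity), ← ENNReal.ofReal_mul (by positivity),
      ← ENNReal.ofReal_mul (by positivity), ← hmono.map_min, ← mul_assoc,
      ← ENNReal.ofReal_mul (by positivity), ← ENNReal.ofReal_mul (by positivity), hW,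
      ← ENNReal.ofReal_mul (by positivity)]
    refine ENNReal.ofReal_le_ofReal ?_
    rw [← Real.mul_rpow hj.le hk.le, ← Real.mul_rpow hj.le hk.le, mul_assoc (|s| ^ _), hjk,
      mul_min_of_nonneg _ _ (by positivity), mul_min_of_nonneg _ _ (by positivity)]
    have hli : (0 : ℝ) < 2 ^ l * 2 ^ i := by positivity
    refine min_le_min ?_ (le_of_eq ?_)
    · calc ((2 : ℝ) ^ l * 2 ^ i) ^ (1 / p - 1) * (|s| ^ (-((n : ℝ) / 2)) * (2 ^ l * 2 ^ i))
          ≤ ((2 : ℝ) ^ l * 2 ^ i) ^ (1 / p - 1) *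
            (((2 : ℝ) ^ l) ^ (-(1 / 2) : ℝ) * (2 ^ l * 2 ^ i)) := by gcongr
        _ = ((2 : ℝ) ^ l) ^ (-(1 / 2) : ℝ) * ((2 : ℝ) ^ l * 2 ^ i) ^ (1 / p) := by
            rw [Real.rpow_sub_one hli.ne']
            field_simp
        _ = _ := by
            rw [Real.mul_rpow hl0.le hi0.le, ← mul_assoc, ← Real.rpow_add hl0]
            congr 2
            ring
    · rw [← Real.rpow_add hli, ← Real.mul_rpow hl0.le hi0.le]
      congr 1
      ring
  calc seqNorm q (fun j ↦ ENNReal.ofReal (((2 : ℝ) ^ j) ^ (1 / p - 1)) *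
        ∫⁻ x, ‖schrodingerTest s (f j) x * nonlinearity b α w x‖ₑ)
      ≤ seqNorm q (fun j ↦ C₁ * (ENNReal.ofReal (((2 : ℝ) ^ l) ^ (1 / p - 1 / 2)) *
          ∑' k, W (j + k - l) * dyadicSeq p w k ^ (α + 1))) := by
        refine seqNorm_mono fun j ↦ ?_
        have hj := h₁ w (schrodingerTest s (f j))
          (ENNReal.ofReal (|s| ^ (-((n : ℝ) / 2))) * ENNReal.ofReal (2 ^ j))
          (ENNReal.ofReal (((2 : ℝ) ^ j) ^ (1 / 2 : ℝ)))
          (schrodingerTest s (f j)).continuous.aestronglyMeasurable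
          (fun x ↦ (enorm_schrodingerTest_le hs (f j) x).trans (mul_le_mul' le_rfl (hf j).1))
          ((eLpNorm_two_schrodingerTest s (f j)).le.trans (hf j).2)
        refine (mul_le_mul' le_rfl hj).trans ?_
        rw [mul_left_comm]
        refine mul_le_mul' le_rfl ?_
        rw [← ENNReal.tsum_mul_left, ← ENNReal.tsum_mul_left]
        refine ENNReal.tsum_le_tsum fun k ↦ ?_
        rw [← mul_assoc (ENNReal.ofReal (((2 : ℝ) ^ l) ^ (1 / p - 1 / 2)))]
        refine le_trans (le_of_eq ?_) (mul_le_mul' (hkernel j k) le_rfl)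
        ring
    _ = C₁ * (ENNReal.ofReal (((2 : ℝ) ^ l) ^ (1 / p - 1 / 2)) *
          seqNorm q (fun j ↦ ∑' k, W (j + k - l) * dyadicSeq p w k ^ (α + 1))) := by
        rw [seqNorm_const_mul hq0, seqNorm_const_mul hq0]
    _ ≤ C₁ * (ENNReal.ofReal (2 ^ (1 / 2 - 1 / p) * |s| ^ (-(n * (1 / 2 - 1 / p)))) *
          ((∑' i, W i) * (C₂ * lorentzNorm p q w) ^ (α + 1))) := by
        refine mul_le_mul' le_rfl (mul_le_mul' (ENNReal.ofReal_le_ofReal hscale)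
          ((seqNorm_convolution_le hq1 W _ l).trans (mul_le_mul' le_rfl ?_)))
        exact (seqNorm_rpow_le hq0 _ (by linarith)).trans
          (ENNReal.rpow_le_rpow (h₂ w) (by linarith))
    _ = _ := by
        rw [ENNReal.ofReal_mul (by positivity),
          ENNReal.mul_rpow_of_nonneg _ _ (by linarith : 0 ≤ α + 1)]
        ring

/-! ### Time integration and the Duhamel tail -/

/-- Split at 2t. Up to 2t the factor τ^{-c} is at most t^{-c} and the singularity is integrable
since a < 1; beyond it τ - t ≥ τ/2, and the integrand is at most a multiple of τ^{-1-β}. -/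
theorem exists_lintegral_Ioi_rpow_mul_rpow_le {a c β : ℝ} (ha0 : 0 ≤ a) (ha : a < 1) (_hc : 0 ≤ c)
    (hβ : 0 < β) (hac : a + c = 1 + β) : ∃ K : ℝ, ∀ t : ℝ, 0 < t →
      ∫⁻ τ in Ioi t, ENNReal.ofReal ((τ - t) ^ (-a) * τ ^ (-c)) ≤
        ENNReal.ofReal (K * t ^ (-β)) := by
  refine ⟨1 / (1 - a) + 2 ^ a * (1 / β), fun t ht ↦ ?_⟩
  have hsplit : Ioi t = Ioc t (2 * t) ∪ Ioi (2 * t) := (Ioc_union_Ioi_eq_Ioi (by linarith)).symm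
  have h1 : ∫⁻ τ in Ioc t (2 * t), ENNReal.ofReal ((τ - t) ^ (-a) * τ ^ (-c)) ≤
      ENNReal.ofReal (1 / (1 - a) * t ^ (-β)) := by
    have hii : IntervalIntegrable (fun τ ↦ (τ - t) ^ (-a) * t ^ (-c)) volume t (2 * t) := by
      have := (intervalIntegral.intervalIntegrable_rpow' (a := 0) (b := t)
        (by linarith : -1 < -a)).comp_sub_right t
      rw [zero_add, ← two_mul] at this
      exact this.mul_const _
    have hval : ∫ τ in t..(2 * t), (τ - t) ^ (-a) * t ^ (-c) = 1 / (1 - a) * t ^ (-β) := by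
      rw [intervalIntegral.integral_mul_const,
        intervalIntegral.integral_comp_sub_right (fun x ↦ x ^ (-a)),
        integral_rpow (.inl (by linarith)), sub_self, show 2 * t - t = t by ring,
        Real.zero_rpow (by linarith), sub_zero, show -a + 1 = 1 - a by ring, div_mul_eq_mul_div,
        ← Real.rpow_add ht, show 1 - a + -c = -β by linarith]
      ring
    calc ∫⁻ τ in Ioc t (2 * t), ENNReal.ofReal ((τ - t) ^ (-a) * τ ^ (-c))
        ≤ ∫⁻ τ in Ioc t (2 * t), ENNReal.ofReal ((τ - t) ^ (-a) * t ^ (-c)) := by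
          refine setLIntegral_mono' measurableSet_Ioc fun τ hτ ↦ ENNReal.ofReal_le_ofReal ?_
          have : 0 ≤ τ - t := by linarith [hτ.1]
          exact mul_le_mul_of_nonneg_left
            (Real.rpow_le_rpow_of_nonpos ht hτ.1.le (by linarith)) (by positivity)
      _ = ENNReal.ofReal (∫ τ in Ioc t (2 * t), (τ - t) ^ (-a) * t ^ (-c)) := by
          rw [ofReal_integral_eq_lintegral_ofReal
            ((intervalIntegrable_iff_integrableOn_Ioc_of_le (by linarith)).1 hii)]
          refine (ae_restrict_iff' measurableSet_Ioc).2 (.of_forall fun τ hτ ↦ ?_)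
          have : 0 ≤ τ - t := by linarith [hτ.1]
          exact mul_nonneg (by positivity) (by positivity)
      _ = _ := by
          rw [← intervalIntegral.integral_of_le (by linarith), hval]
  have h2 : ∫⁻ τ in Ioi (2 * t), ENNReal.ofReal ((τ - t) ^ (-a) * τ ^ (-c)) ≤
      ENNReal.ofReal (2 ^ a * (1 / β) * t ^ (-β)) := by
    have h2t : 0 < 2 * t := by linarith
    have hint : IntegrableOn (fun τ : ℝ ↦ 2 ^ a * τ ^ (-1 - β)) (Ioi (2 * t)) :=
      (integrableOn_Ioi_rpow_of_lt (by linarith) h2t).const_mul _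
    calc ∫⁻ τ in Ioi (2 * t), ENNReal.ofReal ((τ - t) ^ (-a) * τ ^ (-c))
        ≤ ∫⁻ τ in Ioi (2 * t), ENNReal.ofReal (2 ^ a * τ ^ (-1 - β)) := by
          refine setLIntegral_mono' measurableSet_Ioi fun τ hτ ↦ ENNReal.ofReal_le_ofReal ?_
          have hτ' : 2 * t < τ := hτ
          have hτ0 : 0 < τ := h2t.trans hτ'
          have e1 : (τ - t) ^ (-a) ≤ (τ / 2) ^ (-a) :=
            Real.rpow_le_rpow_of_nonpos (by linarith) (by linarith) (by linarith)
          have e2 : (τ / 2) ^ (-a) = 2 ^ a * τ ^ (-a) := by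
            rw [Real.div_rpow hτ0.le (by norm_num), Real.rpow_neg (by norm_num : (0 : ℝ) ≤ 2),
              div_inv_eq_mul, mul_comm]
          calc (τ - t) ^ (-a) * τ ^ (-c) ≤ (2 ^ a * τ ^ (-a)) * τ ^ (-c) := by
                rw [← e2]
                exact mul_le_mul_of_nonneg_right e1 (by positivity)
            _ = _ := by
                rw [mul_assoc, ← Real.rpow_add hτ0, show -a + -c = -1 - β by linarith]
      _ = ENNReal.ofReal (∫ τ in Ioi (2 * t), 2 ^ a * τ ^ (-1 - β)) := by
          rw [ofReal_integral_eq_lintegral_ofReal hint]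
          refine (ae_restrict_iff' measurableSet_Ioi).2 (.of_forall fun τ hτ ↦ ?_)
          have : 0 ≤ τ := (h2t.trans hτ).le
          exact mul_nonneg (by positivity) (by positivity)
      _ ≤ _ := by
          refine ENNReal.ofReal_le_ofReal ?_
          rw [integral_const_mul, integral_Ioi_rpow_of_lt (by linarith) h2t,
            show -1 - β + 1 = -β by ring, neg_div_neg_eq, mul_assoc, one_div_mul_eq_div]
          gcongr ?_ * (?_ / ?_)
          exact Real.rpow_le_rpow_of_nonpos ht (by linarith) (by linarith)
  have htp : 0 < t ^ (-β) := by positivity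
  have h1a : 0 < 1 - a := by linarith
  rw [hsplit, add_mul, ENNReal.ofReal_add (by positivity) (by positivity)]
  exact (lintegral_union_le _ _ _).trans (add_le_add h1 h2)

theorem Represents.add {f g : EuclideanSpace ℝ (Fin n) → ℂ}
    {S T : 𝓢'(EuclideanSpace ℝ (Fin n), ℂ)} (hf : Represents f S) (hg : Represents g T) :
    Represents (fun x ↦ f x + g x) (S + T) := fun φ ↦ by
  have h : (fun x ↦ φ x * (f x + g x)) = fun x ↦ φ x * f x + φ x * g x := by
    ext x; ring
  rw [h]
  refine ⟨(hf φ).1.add (hg φ).1, ?_⟩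
  rw [integral_add (hf φ).1 (hg φ).1, ← (hf φ).2, ← (hg φ).2]
  rfl

theorem Represents.smul {f : EuclideanSpace ℝ (Fin n) → ℂ}
    {T : 𝓢'(EuclideanSpace ℝ (Fin n), ℂ)} (c : ℂ) (hf : Represents f T) :
    Represents (fun x ↦ c * f x) (c • T) := fun φ ↦ by
  have h : (fun x ↦ φ x * (c * f x)) = fun x ↦ c * (φ x * f x) := by
    ext x; ring
  rw [h]
  refine ⟨(hf φ).1.const_mul c, ?_⟩
  rw [integral_const_mul, ← (hf φ).2]
  rfl

theorem lorentzNorm_congr_norm {p : ℝ} {q : ℝ≥0∞} {f g : EuclideanSpace ℝ (Fin n) → ℂ}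
    (h : ∀ x, ‖f x‖ = ‖g x‖) : lorentzNorm p q f = lorentzNorm p q g := by
  simp only [lorentzNorm, rearrangement, distribFun, h]

theorem exists_smul_isTest (f : 𝓢(EuclideanSpace ℝ (Fin n), ℂ)) : ∃ c : ℂ, c ≠ 0 ∧
    eLpNorm (c • f : 𝓢(EuclideanSpace ℝ (Fin n), ℂ)) 1 volume ≤ 1 ∧
    eLpNorm (c • f : 𝓢(EuclideanSpace ℝ (Fin n), ℂ)) 2 volume ≤ 1 := by
  set N₁ := (eLpNorm f 1 volume).toReal with hN₁
  set N₂ := (eLpNorm f 2 volume).toReal with hN₂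
  have h₁ : 0 ≤ N₁ := ENNReal.toReal_nonneg
  have h₂ : 0 ≤ N₂ := ENNReal.toReal_nonneg
  have hpos : 0 < (1 + N₁ + N₂)⁻¹ := by positivity
  have key : ∀ p : ℝ≥0∞, (eLpNorm f p volume).toReal ≤ 1 + N₁ + N₂ →
      eLpNorm ((((1 + N₁ + N₂)⁻¹ : ℝ) : ℂ) • f : 𝓢(EuclideanSpace ℝ (Fin n), ℂ)) p volume ≤ 1 := by
    intro p hp
    have e1 : (((((1 + N₁ + N₂)⁻¹ : ℝ) : ℂ) • f : 𝓢(EuclideanSpace ℝ (Fin n), ℂ)) :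
      EuclideanSpace ℝ (Fin n) → ℂ) = (((1 + N₁ + N₂)⁻¹ : ℝ) : ℂ) • (f : _ → ℂ) := rfl
    rw [e1, eLpNorm_const_smul, ← ofReal_norm, Complex.norm_real, Real.norm_of_nonneg hpos.le,
      ← ENNReal.ofReal_toReal (f.memLp p volume).2.ne, ← ENNReal.ofReal_mul hpos.le,
      ← ENNReal.ofReal_one]
    refine ENNReal.ofReal_le_ofReal ?_
    rw [inv_mul_le_iff₀ (by positivity), mul_one]
    exact hp
  refine ⟨(((1 + N₁ + N₂)⁻¹ : ℝ) : ℂ), by exact_mod_cast hpos.ne', key 1 ?_, key 2 ?_⟩ <;> linarith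

theorem schrodingerTest_smul (t : ℝ) (c : ℂ) (f : 𝓢(EuclideanSpace ℝ (Fin n), ℂ)) :
    schrodingerTest t (c • f) = c • schrodingerTest t f := by
  simp only [schrodingerTest, FourierTransform.fourierInv_smul, map_smul,
    FourierTransform.fourier_smul]

theorem schrodingerTest_add (t : ℝ) (f g : 𝓢(EuclideanSpace ℝ (Fin n), ℂ)) :
    schrodingerTest t (f + g) = schrodingerTest t f + schrodingerTest t g := by
  simp only [schrodingerTest, FourierTransform.fourierInv_add, map_add,
    FourierTransform.fourier_add]

/-- The tail of the Duhamel integral is given by a function in the Lorentz space that decays. -/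
theorem exists_duhamel_tail (hn : 0 < n) {b α p β : ℝ} (hb : 0 < b) (hα : 0 < α) (hp : 2 < p)
    (hβ : 0 < β) (hexp : b / n + (α + 1) / p = 1 - 1 / p)
    (hscal : n * (1 / 2 - 1 / p) + β * α = 1) {q : ℝ≥0∞} (hq1 : 1 < q) :
    ∃ C : ℝ≥0∞, C ≠ ∞ ∧ ∀ (u : ℝ → EuclideanSpace ℝ (Fin n) → ℂ)
      (G : ℝ → 𝓢'(EuclideanSpace ℝ (Fin n), ℂ)) (N : ℝ≥0∞), N ≠ ∞ →
      (∀ t, 0 < t → lorentzNorm p q (u t) ≤ ENNReal.ofReal (t ^ (-β)) * N) →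
      (∀ t, 0 < t → Represents (nonlinearity b α (u t)) (G t)) →
      (∀ σ f, AEStronglyMeasurable (fun τ ↦ G τ (schrodingerTest (σ - τ) f))
        (volume.restrict (Ioi 0))) →
      ∀ t σ : ℝ, 0 < t → σ ≤ t →
        (∀ f, IntegrableOn (fun τ ↦ G τ (schrodingerTest (σ - τ) f)) (Ioi t)) ∧
        ∃ (g : EuclideanSpace ℝ (Fin n) → ℂ) (T : 𝓢'(EuclideanSpace ℝ (Fin n), ℂ)),
          StronglyMeasurable g ∧ Represents g T ∧
          (∀ f, T f = ∫ τ in Ioi t, G τ (schrodingerTest (σ - τ) f)) ∧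
          lorentzNorm p q g ≤ C * ENNReal.ofReal (t ^ (-β)) * N ^ (α + 1) := by
  have hq0 : q ≠ 0 := (zero_lt_one.trans hq1).ne'
  have hp2 : 1 / p < 1 / 2 := one_div_lt_one_div_of_lt two_pos hp
  have hn' : (0 : ℝ) < n := by exact_mod_cast hn
  set a : ℝ := n * (1 / 2 - 1 / p) with ha
  have ha0 : 0 < a := mul_pos hn' (by linarith)
  have hβα : 0 < β * α := by positivity
  obtain ⟨C₁, hC₁, h₁⟩ := exists_seqNorm_pairing_le hn hb hα hp hexp hq1
  obtain ⟨C₂, hC₂, h₂⟩ := exists_represents_lorentzNorm_le (n := n) (by linarith : 0 < p) hq0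
  obtain ⟨K, hK⟩ := exists_lintegral_Ioi_rpow_mul_rpow_le ha0.le (by linarith : a < 1)
    (by positivity : 0 ≤ β * (α + 1)) hβ (by linarith)
  refine ⟨C₂ * (C₁ * ENNReal.ofReal K), ENNReal.mul_ne_top hC₂ (ENNReal.mul_ne_top hC₁
    ENNReal.ofReal_ne_top), fun u G N hN hu hG hmeas t σ ht hσ ↦ ?_⟩
  have hNα : N ^ (α + 1) ≠ ∞ := ENNReal.rpow_ne_top_of_nonneg (by linarith) hN
  have hmeas' : ∀ f, AEStronglyMeasurable (fun τ ↦ G τ (schrodingerTest (σ - τ) f))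
      (volume.restrict (Ioi t)) := fun f ↦
    (hmeas σ f).mono_measure (Measure.restrict_mono (Ioi_subset_Ioi ht.le) le_rfl)
  -- This majorant is independent of σ and of the test family.
  set m : ℝ → ℝ≥0∞ := fun τ ↦ C₁ * N ^ (α + 1) *
    ENNReal.ofReal ((τ - t) ^ (-a) * τ ^ (-(β * (α + 1)))) with hm
  have hmint : ∫⁻ τ in Ioi t, m τ ≤ C₁ * N ^ (α + 1) * ENNReal.ofReal (K * t ^ (-β)) := by
    rw [hm, lintegral_const_mul' _ _ (ENNReal.mul_ne_top hC₁ hNα)]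
    exact mul_le_mul' le_rfl (hK t ht)
  have hmtop : C₁ * N ^ (α + 1) * ENNReal.ofReal (K * t ^ (-β)) ≠ ∞ :=
    ENNReal.mul_ne_top (ENNReal.mul_ne_top hC₁ hNα) ENNReal.ofReal_ne_top
  have hpt : ∀ f : ℤ → 𝓢(EuclideanSpace ℝ (Fin n), ℂ), IsTestFamily f → ∀ τ ∈ Ioi t,
      seqNorm q (fun j ↦ ENNReal.ofReal (((2 : ℝ) ^ j) ^ (1 / p - 1)) *
        ‖G τ (schrodingerTest (σ - τ) (f j))‖ₑ) ≤ m τ := by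
    intro f hf τ hτ
    have hτt : t < τ := hτ
    have hτ0 : 0 < τ := ht.trans hτt
    have hne : σ - τ ≠ 0 := by linarith
    refine (seqNorm_mono fun j ↦ mul_le_mul' le_rfl ?_).trans
      ((h₁ (u τ) (σ - τ) hne f hf).trans ?_)
    · rw [((hG τ hτ0) _).2]
      exact enorm_integral_le_lintegral_enorm _
    -- Since σ ≤ t < τ, the elapsed time |σ - τ| is at least τ - t.
    · have e1 : |σ - τ| ^ (-a) ≤ (τ - t) ^ (-a) := by
        refine Real.rpow_le_rpow_of_nonpos (by linarith) ?_ (by linarith)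
        rw [abs_sub_comm, abs_of_nonneg (by linarith)]
        linarith
      have e2 : lorentzNorm p q (u τ) ^ (α + 1) ≤
          ENNReal.ofReal (τ ^ (-(β * (α + 1)))) * N ^ (α + 1) := by
        refine (ENNReal.rpow_le_rpow (hu τ hτ0) (by linarith)).trans (le_of_eq ?_)
        rw [ENNReal.mul_rpow_of_nonneg _ _ (by linarith), ENNReal.ofReal_rpow_of_pos
          (by positivity), ← Real.rpow_mul hτ0.le, neg_mul]
      refine (mul_le_mul' (mul_le_mul' le_rfl (ENNReal.ofReal_le_ofReal e1)) e2).trans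
        (le_of_eq ?_)
      have : 0 ≤ (τ - t) ^ (-a) := Real.rpow_nonneg (by linarith) _
      simp only [hm]
      rw [ENNReal.ofReal_mul this]
      ring
  -- A multiple of f is placed at level 0 of a test family. Integrability must come first, since
  -- additivity of T₀ depends on it.
  have hint : ∀ f, IntegrableOn (fun τ ↦ G τ (schrodingerTest (σ - τ) f)) (Ioi t) := by
    intro f
    obtain ⟨c, hc0, hc1, hc2⟩ := exists_smul_isTest f
    have hscaled : IntegrableOn (fun τ ↦ G τ (schrodingerTest (σ - τ) (c • f))) (Ioi t) := by
      refine ⟨hmeas' _, ?_⟩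
      refine lt_of_le_of_lt ?_ (hmint.trans_lt (lt_top_iff_ne_top.2 hmtop))
      refine setLIntegral_mono' measurableSet_Ioi fun τ hτ ↦ ?_
      have htest : IsTestFamily (Function.update
          (0 : ℤ → 𝓢(EuclideanSpace ℝ (Fin n), ℂ)) 0 (c • f)) := fun j ↦ by
        by_cases hj : j = 0
        · subst hj
          simpa using ⟨hc1, hc2⟩
        · rw [Function.update_of_ne hj]
          simp
      simpa using (le_seqNorm hq0 _ 0).trans (hpt _ htest τ hτ)
    simp only [schrodingerTest_smul, map_smul] at hscaled
    have := hscaled.smul c⁻¹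
    unfold IntegrableOn
    simpa only [Pi.smul_def, inv_smul_smul₀ hc0] using this
  refine ⟨hint, ?_⟩
  let T₀ : 𝓢(EuclideanSpace ℝ (Fin n), ℂ) →ₗ[ℂ] ℂ :=
    { toFun := fun f ↦ ∫ τ in Ioi t, G τ (schrodingerTest (σ - τ) f)
      map_add' := fun f g ↦ by
        simp only [schrodingerTest_add, map_add]
        exact integral_add (hint f) (hint g)
      map_smul' := fun c f ↦ by
        simp only [schrodingerTest_smul, map_smul, RingHom.id_apply]
        exact integral_smul c _ }
  obtain ⟨g, T, hg, hT, hrep, hle⟩ := h₂ T₀ _ hmtop fun f hf ↦ by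
    calc seqNorm q (fun j ↦ ENNReal.ofReal (((2 : ℝ) ^ j) ^ (1 / p - 1)) * ‖T₀ (f j)‖ₑ)
        ≤ seqNorm q (fun j ↦ ∫⁻ τ in Ioi t, ENNReal.ofReal (((2 : ℝ) ^ j) ^ (1 / p - 1)) *
            ‖G τ (schrodingerTest (σ - τ) (f j))‖ₑ) := by
          refine seqNorm_mono fun j ↦ ?_
          rw [lintegral_const_mul' _ _ ENNReal.ofReal_ne_top]
          exact mul_le_mul' le_rfl (enorm_integral_le_lintegral_enorm _)
      _ ≤ ∫⁻ τ in Ioi t, m τ :=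
          seqNorm_lintegral_le hq1 (fun j ↦ (hmeas' (f j)).enorm.const_mul _)
            ((ae_restrict_iff' measurableSet_Ioi).2 (.of_forall (hpt f hf)))
      _ ≤ _ := hmint
  refine ⟨g, T, hg, hrep, hT, hle.trans ?_⟩
  have htp : 0 ≤ t ^ (-β) := by positivity
  rw [ENNReal.ofReal_mul' htp]
  exact le_of_eq (by ring)

/-- The integrability in the equation at time t, tested on e^{i(σ-t)Δ}f, becomes integrability at
elapsed time σ - τ by the group law. Measurability on (0, ∞) follows by exhausting it with bounded
intervals. -/
theorem integrableOn_duhamel {γ : ℝ} {φ : 𝓢'(EuclideanSpace ℝ (Fin n), ℂ)}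
    {U G : ℝ → 𝓢'(EuclideanSpace ℝ (Fin n), ℂ)}
    (h : ∀ t, 0 < t → ∀ f : 𝓢(EuclideanSpace ℝ (Fin n), ℂ),
      IntegrableOn (fun τ ↦ schrodinger (t - τ) (G τ) f) (Ioo 0 t) ∧
      U t f = schrodinger t φ f +
        Complex.I * (γ : ℂ) * ∫ τ in Ioo 0 t, schrodinger (t - τ) (G τ) f)
    (σ : ℝ) (f : 𝓢(EuclideanSpace ℝ (Fin n), ℂ)) :
    (∀ t, 0 < t → IntegrableOn (fun τ ↦ G τ (schrodingerTest (σ - τ) f)) (Ioo 0 t)) ∧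
    AEStronglyMeasurable (fun τ ↦ G τ (schrodingerTest (σ - τ) f)) (volume.restrict (Ioi 0)) := by
  have hint : ∀ t, 0 < t →
      IntegrableOn (fun τ ↦ G τ (schrodingerTest (σ - τ) f)) (Ioo 0 t) := fun t ht ↦ by
    have := (h t ht (schrodingerTest (σ - t) f)).1
    simp only [schrodinger_apply, schrodingerTest_schrodingerTest] at this
    refine this.congr (.of_forall fun τ ↦ ?_)
    simp only
    rw [show t - τ + (σ - t) = σ - τ by ring]
  refine ⟨hint, ?_⟩
  have hU : Ioi (0 : ℝ) = ⋃ k : ℕ, Ioo 0 ((k : ℝ) + 1) := by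
    ext x
    simp only [mem_Ioi, mem_iUnion, mem_Ioo]
    refine ⟨fun hx ↦ ?_, fun ⟨_, hx⟩ ↦ hx.1⟩
    obtain ⟨k, hk⟩ := exists_nat_gt x
    exact ⟨k, hx, hk.trans (lt_add_one _)⟩
  rw [hU, aestronglyMeasurable_iUnion_iff]
  exact fun k ↦ (hint _ (by positivity)).aestronglyMeasurable

/-! ### Arithmetic of the exponents -/

theorem betaExp_pos {b α : ℝ} (hb2 : b < 2) (hα : 0 < α)
    (hα_upper : (α : EReal) < upperExponent n b) : 0 < betaExp n b α := by
  refine div_pos ?_ (by positivity)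
  by_cases h : 3 ≤ n
  · rw [upperExponent, if_pos h, EReal.coe_lt_coe_iff] at hα_upper
    have h3 : (3 : ℝ) ≤ n := by exact_mod_cast h
    rw [lt_div_iff₀ (by linarith)] at hα_upper
    linarith
  · have h2 : (n : ℝ) ≤ 2 := by exact_mod_cast (by omega : n ≤ 2)
    nlinarith

theorem two_lt_rExp {b α : ℝ} (hb : 0 < b) (hbn : b < n) (hα : 0 < α) : 2 < rExp n b α := by
  rw [rExp, lt_div_iff₀ (by linarith)]
  have : 0 < (n : ℝ) * α := mul_pos (hb.trans hbn) hα
  linarith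

theorem one_div_rExp {b α : ℝ} : 1 / rExp n b α = ((n : ℝ) - b) / (n * (α + 2)) := by
  rw [rExp, one_div_div]

theorem rExp_holder {b α : ℝ} (hb : 0 < b) (hbn : b < n) (hα : 0 < α) :
    b / n + (α + 1) / rExp n b α = 1 - 1 / rExp n b α := by
  have hn : (n : ℝ) ≠ 0 := (hb.trans hbn).ne'
  have h2 : α + 2 ≠ 0 := by linarith
  rw [div_eq_mul_one_div (α + 1), one_div_rExp]
  field_simp
  ring

/-- The scale invariance of the problem: the dispersive decay rate and the time weight of |u|^α
together have exponent exactly 1. -/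
theorem rExp_betaExp_scaling {b α : ℝ} (hb : 0 < b) (hbn : b < n) (hα : 0 < α) :
    n * (1 / 2 - 1 / rExp n b α) + betaExp n b α * α = 1 := by
  have hn : (n : ℝ) ≠ 0 := (hb.trans hbn).ne'
  have h2 : α + 2 ≠ 0 := by linarith
  rw [one_div_rExp, betaExp]
  field_simp
  ring

theorem lorentzNorm_le_tripleNorm (b α : ℝ) (q : ℝ≥0∞)
    (u : ℝ → EuclideanSpace ℝ (Fin n) → ℂ) {t : ℝ} (ht : 0 < t) :
    lorentzNorm (rExp n b α) q (u t) ≤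
      ENNReal.ofReal (t ^ (-betaExp n b α)) * tripleNorm b α q u := by
  have h : ENNReal.ofReal (t ^ betaExp n b α) * lorentzNorm (rExp n b α) q (u t) ≤
      tripleNorm b α q u :=
    le_iSup₂ (f := fun (t : ℝ) (_ : 0 < t) ↦
      ENNReal.ofReal (t ^ betaExp n b α) * lorentzNorm (rExp n b α) q (u t)) t ht
  refine le_trans (le_of_eq ?_) (mul_le_mul' le_rfl h)
  rw [← mul_assoc, ← ENNReal.ofReal_mul (by positivity), ← Real.rpow_add ht, neg_add_cancel,
    Real.rpow_zero, ENNReal.ofReal_one, one_mul]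

end INLS

/-! ### The scattering state and the conclusion -/

theorem theorem1p3 (n : ℕ) (b α α₀ : ℝ) (q : ℝ≥0∞) (γ : ℝ)
    (hb : 0 < b) (hb2 : b < 2) (hbn : b < n)
    (hγ : γ = 1 ∨ γ = -1)
    (hα₀ : 0 < α₀)
    (hα₀_root : (n : ℝ) * α₀ ^ 2 + ((n : ℝ) - 2 + 2 * b) * α₀ - 4 + 2 * b = 0)
    (hα_lower : α₀ < α) (hα_upper : (α : EReal) < INLS.upperExponent n b)
    (hq : ENNReal.ofReal (INLS.rExp n b α) < q) :
    ∃ C : ℝ, 0 < C ∧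
      ∀ (φ : 𝓢'(EuclideanSpace ℝ (Fin n), ℂ)) (u : ℝ → EuclideanSpace ℝ (Fin n) → ℂ),
        u ∈ INLS.classX n b α q → INLS.IsSolution b α γ φ u →
        ∃ ψ ∈ INLS.classW n b α q, ∀ t : ℝ, 0 < t →
          ∃ U : 𝓢'(EuclideanSpace ℝ (Fin n), ℂ), INLS.Represents (u t) U ∧
            INLS.distLorentzNorm (INLS.rExp n b α) q (INLS.schrodinger (-t) U - ψ) ≤
              ENNReal.ofReal (C * t ^ (-INLS.betaExp n b α)) *
                INLS.tripleNorm b α q u ^ (α + 1) := by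
  open INLS in
  have hα : 0 < α := hα₀.trans hα_lower
  have hn : 0 < n := by
    have : (0 : ℝ) < n := hb.trans hbn
    exact_mod_cast this
  have hβ : 0 < betaExp n b α := betaExp_pos hb2 hα hα_upper
  have hp : 2 < rExp n b α := two_lt_rExp hb hbn hα
  have hq1 : 1 < q := by
    refine lt_of_le_of_lt ?_ hq
    rw [← ENNReal.ofReal_one]
    exact ENNReal.ofReal_le_ofReal (by linarith)
  obtain ⟨C₁, hC₁, tail⟩ := exists_duhamel_tail hn hb hα hp hβ (rExp_holder hb hbn hα)
    (rExp_betaExp_scaling hb hbn hα) hq1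
  obtain ⟨C₂, hC₂, hadd⟩ := lorentzNorm_add_le (n := n) (by linarith : 0 < rExp n b α) hq1
  refine ⟨C₁.toReal + 1, by positivity, fun φ u hu ⟨U, G, hU, hG, heq⟩ ↦ ?_⟩
  set N := tripleNorm b α q u with hN
  set β := betaExp n b α with hβdef
  set p := rExp n b α with hpdef
  have hNtop : N ≠ ∞ := hu.2.ne
  have hκ : ‖Complex.I * (γ : ℂ)‖ = 1 := by
    rcases hγ with rfl | rfl <;> simp
  set κ : ℂ := Complex.I * (γ : ℂ) with hκdef
  have htail := tail u G N hNtop (fun t ht ↦ lorentzNorm_le_tripleNorm b α q u ht) hG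
    (fun σ f ↦ (integrableOn_duhamel heq σ f).2)
  have htail0 : ∀ t : ℝ, 0 < t → _ := fun t ht ↦ htail t 0 ht ht.le
  have htailt : ∀ t : ℝ, 0 < t → _ := fun t ht ↦ htail t t ht le_rfl
  -- The right side contains no t: this is the conserved quantity that defines the scattering state.
  have hflow : ∀ t : ℝ, 0 < t → ∀ f : 𝓢(EuclideanSpace ℝ (Fin n), ℂ),
      schrodinger (-t) (U t) f + κ * ∫ τ in Ioi t, G τ (schrodingerTest (0 - τ) f) =
        φ f + κ * ∫ τ in Ioi 0, G τ (schrodingerTest (0 - τ) f) := by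
    intro t ht f
    have h1 := (heq t ht (schrodingerTest (-t) f)).2
    simp only [schrodinger_apply, schrodingerTest_schrodingerTest, add_neg_cancel,
      schrodingerTest_zero] at h1
    have h2 : ∀ τ : ℝ, t - τ + -t = 0 - τ := fun τ ↦ by ring
    simp only [h2] at h1
    rw [schrodinger_apply, h1, add_assoc, ← mul_add, ← integral_Ioc_eq_integral_Ioo,
      ← setIntegral_union Ioc_disjoint_Ioi_same measurableSet_Ioi
        ((integrableOn_Ioc_iff_integrableOn_Ioo).2 ((integrableOn_duhamel heq 0 f).1 t ht))
        ((htail0 t ht).1 f), Ioc_union_Ioi_eq_Ioi ht.le]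
  -- Time 1 is an arbitrary choice. Starting at a positive time presents ψ as a sum of two tempered
  -- distributions, the tail being one by the Lorentz bound; that bound is not available from time
  -- 0.
  obtain ⟨g₁, R₁, -, -, hR₁, -⟩ := (htail0 1 one_pos).2
  set ψ : 𝓢'(EuclideanSpace ℝ (Fin n), ℂ) := schrodinger (-1) (U 1) + κ • R₁ with hψ
  have hψf : ∀ t : ℝ, 0 < t → ∀ f : 𝓢(EuclideanSpace ℝ (Fin n), ℂ),
      ψ f = schrodinger (-t) (U t) f +
        κ * ∫ τ in Ioi t, G τ (schrodingerTest (0 - τ) f) := fun t ht f ↦ by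
    rw [hflow t ht, ← hflow 1 one_pos, ← hR₁]
    rfl
  refine ⟨ψ, ?_, fun t ht ↦ ⟨U t, hU t ht, ?_⟩⟩
  -- The function given by e^{itΔ}ψ is u(t) + κg, with g the tail at σ = t; the condition 0 < t sits
  -- inside so that v can be chosen for all real t.
  · have hv : ∀ t : ℝ, ∃ v : EuclideanSpace ℝ (Fin n) → ℂ, 0 < t →
        AEStronglyMeasurable v volume ∧ Represents v (schrodinger t ψ) ∧
        ENNReal.ofReal (t ^ β) * lorentzNorm p q v ≤ C₂ * (N + C₁ * N ^ (α + 1)) := by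
      intro t
      by_cases ht : 0 < t
      · obtain ⟨g, R, hg, hrep, hR, hle⟩ := (htailt t ht).2
        refine ⟨fun x ↦ u t x + κ * g x, fun _ ↦
          ⟨(hu.1 t ht).add (hg.aestronglyMeasurable.const_mul κ), ?_, ?_⟩⟩
        · have : schrodinger t ψ = U t + κ • R := by
            ext f
            rw [schrodinger_apply, hψf t ht, schrodinger_apply, schrodingerTest_schrodingerTest,
              neg_add_cancel, schrodingerTest_zero]
            simp only [schrodingerTest_schrodingerTest]
            have h2 : ∀ τ : ℝ, 0 - τ + t = t - τ := fun τ ↦ by ring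
            simp only [h2, ← hR]
            rfl
          rw [this]
          exact (hU t ht).add (hrep.smul κ)
        · have hnorm := hadd (u t) g (fun x ↦ u t x + κ * g x) fun x ↦ by
            refine (norm_add_le _ _).trans (le_of_eq ?_)
            rw [norm_mul, hκ, one_mul]
          have hut := lorentzNorm_le_tripleNorm b α q u ht
          have hcancel : ENNReal.ofReal (t ^ β) * ENNReal.ofReal (t ^ (-β)) = 1 := by
            rw [← ENNReal.ofReal_mul (by positivity), ← Real.rpow_add ht, add_neg_cancel,
              Real.rpow_zero, ENNReal.ofReal_one]
          calc ENNReal.ofReal (t ^ β) * lorentzNorm p q (fun x ↦ u t x + κ * g x)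
              ≤ ENNReal.ofReal (t ^ β) * (C₂ * (ENNReal.ofReal (t ^ (-β)) * N +
                  C₁ * ENNReal.ofReal (t ^ (-β)) * N ^ (α + 1))) :=
                mul_le_mul' le_rfl (hnorm.trans (mul_le_mul' le_rfl (add_le_add hut hle)))
            _ = (ENNReal.ofReal (t ^ β) * ENNReal.ofReal (t ^ (-β))) *
                  (C₂ * (N + C₁ * N ^ (α + 1))) := by ring
            _ = _ := by rw [hcancel, one_mul]
      · exact ⟨0, fun h ↦ absurd h ht⟩
    choose v hv using hv
    refine ⟨v, ⟨fun t ht ↦ (hv t ht).1, ?_⟩, fun t ht ↦ (hv t ht).2.1⟩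
    refine lt_of_le_of_lt (iSup₂_le fun t ht ↦ (hv t ht).2.2) (lt_top_iff_ne_top.2 ?_)
    exact ENNReal.mul_ne_top hC₂ (ENNReal.add_ne_top.2 ⟨hNtop, ENNReal.mul_ne_top hC₁
      (ENNReal.rpow_ne_top_of_nonneg (by linarith) hNtop)⟩)
  · obtain ⟨g, R, -, hrep, hR, hle⟩ := (htail0 t ht).2
    -- Here R is the tail at σ = 0, and |κ| = 1 leaves its norm unchanged.
    have hsub : schrodinger (-t) (U t) - ψ = (-κ) • R := by
      ext f
      have h1 := hψf t ht f
      rw [← hR] at h1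
      change schrodinger (-t) (U t) f - ψ f = -κ * R f
      rw [h1]
      ring
    rw [hsub]
    refine (iInf₂_le (fun x ↦ -κ * g x) (hrep.smul (-κ))).trans ?_
    rw [lorentzNorm_congr_norm (g := g) fun x ↦ by rw [norm_mul, norm_neg, hκ, one_mul],
      ENNReal.ofReal_mul (by positivity)]
    refine hle.trans (mul_le_mul' (mul_le_mul' ?_ le_rfl) le_rfl)
    rw [← ENNReal.ofReal_toReal hC₁]
    exact ENNReal.ofReal_le_ofReal (by simp)
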